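/- Let $G=(V,E)$ be a finite connected graph with at least one edge (loops and multiple edges allowed), with an orientation of the edges, and let $|G|$ be the topological space obtained by gluing $\#E$ intervals according to $G$. For lengths $\vec l\in\,]0,+\infty[^E$, parametrize the edge $e$ by arc length $t_e\in[-l_e/2,l_e/2]$, and let $\Delta_{\vec l}$ be the operator $-d^2/dt_e^2$ on $L^2(|G|)=\bigoplus_e L^2([-l_e/2,l_e/2];\mathbb C)$ whose domain consists of the functions in $\bigoplus_e H^2(e)$ that are continuous on $|G|$ and satisfy the Kirchhoff condition (at each vertex, the outgoing derivatives sum to $0$). For $k>0$ and $\phi(t_e)=a_e\cos kt_e+b_e\sin kt_e$ on each edge $e$, the continuity conditions and the Kirchhoff conditions (the latter divided by $k$) at the vertices form a linear system of $2\#E$ equations in the $2\#E$ unknowns $(a_e,b_e)_{e\in E}$, whose coefficients depend only on $\theta_e=kl_e$ (through $\cos(\theta_e/2)$ and $\sin(\theta_e/2)$); at a vertex of degree $d$, the $d-1$ continuity equations equate the values of $\phi$ at the ends meeting there with its value at one chosen end. The determinant of this system is a smooth function $\delta_G(\theta)$ on the torus $\mathcal T_E=(\mathbb R/2\pi\mathbb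 Z)^E$, which depends on the choices only up to a nonzero constant factor. Let $Z_G=\{\theta\in\mathcal T_E:\delta_G(\theta)=0\}$. A point of $Z_G$ is called smooth if the differential of $\delta_G$ at that point is nonzero, and singular otherwise. Write $[k\vec l]\in\mathcal T_E$ for the class of $k\vec l$ modulo $2\pi$. Then: 1. If $k>0$ and $k^2$ is a simple eigenvalue of $\Delta_{\vec l}$, then $[k\vec l]$ is a smooth point of $Z_G$. Moreover every eigenfunction $\phi\neq0$ for $k^2$ has the form $\phi(t_e)=a_e\cos kt_e+b_e\sin kt_e$ on each edge $e$, with $a_e,b_e\in\mathbb C$, and the tangent space to $Z_G$ at $[k\vec l]$ (the set of initial velocities of smooth curves in $Z_G$ through that point) is $\{v\in\mathbb R^E:\sum_e m_ev_e=0\}$, that is, $\sum_e m_e\,d\theta_e=0$, where $m_e=a_e^2+b_e^2$. 2. If $k>0$ and $k^2$ is a degenerate eigenvalue of $\Delta_{\vec l}$ (of multiplicity at least $2$), then $[k\vec l]$ is a singular point of $Z_G$. 3. If $|G|$ is not homeomorphic to a circle, then the set $Z_G^{\rm sing}$ of singular points has codimension at least $1$ with respect to $Z_G$: for every $z\in Z_G^{\rm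 sing}$ and every neighbourhood $U$ of $z$, $\dim(Z_G^{\rm sing}\cap U)+1\le\dim(Z_G\cap U)$, where $\dim$ is the Hausdorff dimension. -/

import Mathlib

open MeasureTheory Set Filter Topology
open scoped ENNReal ContDiff

/-- A finite graph, with loops and multiple edges allowed, whose edges have been oriented:
every edge `e` goes from `src e` to `tgt e`. -/
structure OrientedGraph (V E : Type*) where
  src : E → V
  tgt : E → V

/-- The point of the torus `(ℝ / 2πℤ)^E` with coordinates `x e` modulo `2π`. -/
noncomputable def torusPoint {E : Type*} (x : E → ℝ) : E → Real.Angle := fun e => (x e : Real.Angle)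

/-- The vectors tangent at `p` to a subset `Z` of the torus `(ℝ / 2πℤ)^E`: the initial velocities of
smooth curves through `p` that stay in `Z`. Curves are written `t ↦ p + [γ t]`, which identifies the
tangent space of the torus at `p` with `ℝ^E`. -/
def tangentVectors {E : Type*} [Fintype E] (Z : Set (E → Real.Angle)) (p : E → Real.Angle) :
    Set (E → ℝ) :=
  {v | ∃ γ : ℝ → (E → ℝ), ContDiffAt ℝ ∞ γ 0 ∧ γ 0 = 0 ∧ HasDerivAt γ v 0 ∧
    ∀ᶠ t in 𝓝 (0 : ℝ), p + torusPoint (γ t) ∈ Z}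

/-- The subset `S` of `Z` has codimension at least `c` with respect to `Z`, near each of its points.
The (Hausdorff) dimension `dimH` is the usual dimension on semi-algebraic sets. The condition is
local, so for `c ≥ 1` and sets of finite dimension no nonempty relatively open part of `Z` lies
in `S`. -/
def HasCodimAtLeast {X : Type*} [EMetricSpace X] (c : ℝ≥0∞) (S Z : Set X) : Prop :=
  S ⊆ Z ∧ ∀ z ∈ S, ∀ U ∈ 𝓝 z, dimH (S ∩ U) + c ≤ dimH (Z ∩ U)

/-- The eigenspace, for the number `μ`, of an operator `A` defined on a subspace of `H`. -/
def LinearPMap.eigenspace {H : Type*} [AddCommGroup H] [Module ℂ H] (A : H →ₗ.[ℂ] H) (μ : ℂ) :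
    Submodule ℂ H :=
  (LinearMap.ker (A.toFun - μ • A.domain.subtype)).map A.domain.subtype

/-- `μ` is a simple (non degenerate) eigenvalue of `A`. -/
def LinearPMap.IsSimpleEigenvalue {H : Type*} [AddCommGroup H] [Module ℂ H]
    (A : H →ₗ.[ℂ] H) (μ : ℂ) : Prop :=
  Module.rank ℂ (A.eigenspace μ) = 1

/-- `μ` is a degenerate eigenvalue of `A`: its multiplicity is at least two. -/
def LinearPMap.IsDegenerateEigenvalue {H : Type*} [AddCommGroup H] [Module ℂ H]
    (A : H →ₗ.[ℂ] H) (μ : ℂ) : Prop :=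
  1 < Module.rank ℂ (A.eigenspace μ)

/-- `F` is absolutely continuous on `[-l/2, l/2]`, with derivative `F'` almost everywhere. -/
def IsACWithDeriv (l : ℝ) (F F' : ℝ → ℂ) : Prop :=
  IntegrableOn F' (Icc (-l / 2) (l / 2)) ∧
    ∀ t ∈ Icc (-l / 2) (l / 2), F t = F (-l / 2) + ∫ s in (-l / 2)..t, F' s

theorem IsACWithDeriv.intervalIntegrable {l : ℝ} {F F' : ℝ → ℂ} (h : IsACWithDeriv l F F')
    {t : ℝ} (ht : t ∈ Icc (-l / 2) (l / 2)) : IntervalIntegrable F' volume (-l / 2) t := by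
  rw [intervalIntegrable_iff_integrableOn_Icc_of_le ht.1]
  exact h.1.mono_set (Icc_subset_Icc le_rfl ht.2)

theorem IsACWithDeriv.add {l : ℝ} {F F' K K' : ℝ → ℂ} (h : IsACWithDeriv l F F')
    (h' : IsACWithDeriv l K K') : IsACWithDeriv l (F + K) (F' + K') := by
  refine ⟨h.1.add h'.1, fun t ht => ?_⟩
  have := intervalIntegral.integral_add (h.intervalIntegrable ht) (h'.intervalIntegrable ht)
  simp only [Pi.add_apply, this]
  rw [h.2 t ht, h'.2 t ht]
  ring

theorem IsACWithDeriv.smul {l : ℝ} {F F' : ℝ → ℂ} (h : IsACWithDeriv l F F') (c : ℂ) :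
    IsACWithDeriv l (c • F) (c • F') := by
  refine ⟨h.1.smul c, fun t ht => ?_⟩
  simp only [Pi.smul_apply, intervalIntegral.integral_smul]
  rw [h.2 t ht, smul_add]

theorem IsACWithDeriv.congr_deriv {l : ℝ} {F F' K' : ℝ → ℂ} (h : IsACWithDeriv l F F')
    (hK : F' =ᵐ[volume.restrict (Icc (-l / 2) (l / 2))] K') : IsACWithDeriv l F K' := by
  refine ⟨h.1.congr_fun_ae hK, fun t ht => ?_⟩
  rw [h.2 t ht]
  congr 1
  refine intervalIntegral.integral_congr_ae ?_
  filter_upwards [(ae_restrict_iff' measurableSet_Icc).1 hK] with s hs hst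
  rw [uIoc_of_le ht.1] at hst
  exact hs ⟨hst.1.le, hst.2.trans ht.2⟩

theorem IsACWithDeriv.ae_eq_zero {l : ℝ} {F F' : ℝ → ℂ} (h : IsACWithDeriv l F F')
    (hF : F =ᵐ[volume.restrict (Icc (-l / 2) (l / 2))] 0) :
    F' =ᵐ[volume.restrict (Icc (-l / 2) (l / 2))] 0 := by
  rcases lt_or_ge (-l / 2) (l / 2) with hl | hl
  · have hi := h.intervalIntegrable (right_mem_Icc.2 hl.le)
    have hc : ContinuousOn F (Icc (-l / 2) (l / 2)) := by
      have h1 : ContinuousOn (fun t => F (-l / 2) + ∫ s in (-l / 2)..t, F' s)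
          (Icc (-l / 2) (l / 2)) := by
        refine continuousOn_const.add ?_
        have := intervalIntegral.continuousOn_primitive_interval'
          hi (left_mem_uIcc (a := -l / 2) (b := l / 2))
        rwa [uIcc_of_le hl.le] at this
      exact h1.congr h.2
    have h0 : EqOn F 0 (Icc (-l / 2) (l / 2)) :=
      Measure.eqOn_Icc_of_ae_eq volume hl.ne hF hc continuousOn_const
    have hI : ∀ t ∈ Icc (-l / 2) (l / 2), ∫ s in (-l / 2)..t, F' s = 0 := by
      intro t ht
      have := h.2 t ht
      rw [h0 ht, h0 (left_mem_Icc.2 hl.le)] at this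
      simpa using this.symm
    have hd := hi.ae_hasDerivAt_integral
    rw [← restrict_Ioo_eq_restrict_Icc]
    refine (ae_restrict_iff' measurableSet_Ioo).2 ?_
    filter_upwards [hd] with t ht hts
    have h1 := ht (by rw [uIcc_of_le hl.le]; exact Ioo_subset_Icc_self hts) (-l / 2)
      left_mem_uIcc
    have h2 : HasDerivAt (fun x => ∫ s in (-l / 2)..x, F' s) 0 t := by
      refine (hasDerivAt_const t (0 : ℂ)).congr_of_eventuallyEq ?_
      filter_upwards [Icc_mem_nhds hts.1 hts.2] with x hx using hI x hx
    exact h1.unique h2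
  · have : (volume.restrict (Icc (-l / 2) (l / 2))) = 0 := by
      rw [Measure.restrict_eq_zero, Real.volume_Icc, ENNReal.ofReal_eq_zero]
      linarith
    rw [this]
    simp [EventuallyEq]

namespace OrientedGraph

variable {V E : Type*}

/-- The half-edge `(e, false)` is the initial half of the edge `e`, and `(e, true)` its final half.
`vert` gives the vertex to which a half-edge is attached. -/
def vert (G : OrientedGraph V E) (h : E × Bool) : V := if h.2 then G.tgt h.1 else G.src h.1

/-- Connectedness of the graph (in particular there is at least one vertex). -/
def Connected (G : OrientedGraph V E) : Prop :=
  (SimpleGraph.fromRel fun u v => ∃ e, G.src e = u ∧ G.tgt e = v).Connected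

/-- The end point of the closed unit interval labelled by `h.1` that corresponds to `h`. -/
def intervalEnd (h : E × Bool) : Σ _ : E, unitInterval := ⟨h.1, if h.2 then 1 else 0⟩

/-- The gluing relation: end points of intervals that sit at the same vertex. -/
def Glue (G : OrientedGraph V E) (x y : Σ _ : E, unitInterval) : Prop :=
  ∃ h h' : E × Bool, G.vert h = G.vert h' ∧ x = intervalEnd h ∧ y = intervalEnd h'

/-- The one-dimensional singular manifold `|G|`, with the quotient topology: intervals labelled by
`E`, glued according to the combinatorics of `G`. -/
def Realization (G : OrientedGraph V E) : Type _ := Quot G.Glue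

instance (G : OrientedGraph V E) : TopologicalSpace G.Realization :=
  inferInstanceAs (TopologicalSpace (Quot G.Glue))

/-! ### The Laplacian of a metric graph -/

/-- The Lebesgue measure on the edge `[-l/2, l/2]`. -/
noncomputable def edgeMeasure (l : ℝ) : Measure ℝ := volume.restrict (Icc (-l / 2) (l / 2))

/-- The Hilbert space `L²(|G|, |dx|_ℓ)`, the direct sum over the edges `e` of
`L²([-ℓ e / 2, ℓ e / 2])`, for the edge lengths `ℓ`. -/
abbrev L2 [Fintype E] (ℓ : E → ℝ) : Type _ :=
  PiLp 2 fun e : E => Lp ℂ 2 (edgeMeasure (ℓ e))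

/-- The arc-length parameter, centred at the middle of the edge, of the end of `h`. -/
noncomputable def endParam (ℓ : E → ℝ) (h : E × Bool) : ℝ :=
  if h.2 then ℓ h.1 / 2 else -ℓ h.1 / 2

/-- `f` has edgewise derivative `f'`, is continuous on `|G|`, and satisfies the Kirchhoff condition
at each vertex: the outgoing derivatives sum to zero. -/
structure VertexConditions [Fintype E] [DecidableEq V] (G : OrientedGraph V E) (ℓ : E → ℝ)
    (f f' : E → ℝ → ℂ) : Prop where
  continuous : ∀ h h' : E × Bool, G.vert h = G.vert h' →
    f h.1 (endParam ℓ h) = f h'.1 (endParam ℓ h')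
  kirchhoff : ∀ v : V, ∑ h : E × Bool with G.vert h = v,
    (if h.2 then -f' h.1 (endParam ℓ h) else f' h.1 (endParam ℓ h)) = 0

/-- The graph of the Laplacian: pairs `(u, w)` such that `u` lies in `H²` on each edge (it is
represented by a function `f` with absolutely continuous derivative `f'` whose derivative is square
integrable), satisfies the vertex conditions, and has edgewise second derivative `-w`. -/
def laplacianGraph [Fintype E] [DecidableEq V] (G : OrientedGraph V E) (ℓ : E → ℝ) :
    Submodule ℂ (L2 ℓ × L2 ℓ) where
  carrier := {p | ∃ f f' : E → ℝ → ℂ, (∀ e, p.1 e =ᵐ[edgeMeasure (ℓ e)] f e) ∧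
    (∀ e, IsACWithDeriv (ℓ e) (f e) (f' e)) ∧
    (∀ e, IsACWithDeriv (ℓ e) (f' e) (-(p.2 e : ℝ → ℂ))) ∧ G.VertexConditions ℓ f f'}
  zero_mem' := by
    refine ⟨0, 0, fun e => ?_, fun e => ⟨integrableOn_zero, by simp⟩, fun e => ?_,
      ⟨by simp, by simp⟩⟩
    · exact Lp.coeFn_zero _ _ _
    · refine IsACWithDeriv.congr_deriv (F' := 0) ⟨integrableOn_zero, by simp⟩ ?_
      filter_upwards [Lp.coeFn_zero ℂ 2 (edgeMeasure (ℓ e))] with t ht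
      simp only [Prod.snd_zero, PiLp.zero_apply, Pi.neg_apply, ht, Pi.zero_apply, neg_zero]
  add_mem' := by
    rintro p q ⟨f, f', h1, h2, h3, h4⟩ ⟨g, g', k1, k2, k3, k4⟩
    refine ⟨f + g, f' + g', fun e => ?_, fun e => (h2 e).add (k2 e), fun e => ?_, ?_, ?_⟩
    · exact (Lp.coeFn_add _ _).trans ((h1 e).add (k1 e))
    · refine ((h3 e).add (k3 e)).congr_deriv ?_
      filter_upwards [Lp.coeFn_add (p.2 e) (q.2 e)] with t ht
      simp only [Prod.snd_add, PiLp.add_apply, Pi.neg_apply, Pi.add_apply] at ht ⊢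
      rw [ht]
      ring
    · intro h h' hh
      simp [h4.continuous h h' hh, k4.continuous h h' hh]
    · intro v
      rw [← add_zero (0 : ℂ)]
      nth_rewrite 1 [← h4.kirchhoff v]
      rw [← k4.kirchhoff v, ← Finset.sum_add_distrib]
      refine Finset.sum_congr rfl fun h _ => ?_
      by_cases hb : h.2 = true <;> simp [hb]
      ring
  smul_mem' := by
    rintro c p ⟨f, f', h1, h2, h3, h4⟩
    refine ⟨c • f, c • f', fun e => ?_, fun e => (h2 e).smul c, fun e => ?_, ?_, ?_⟩
    · exact (Lp.coeFn_smul _ _).trans ((h1 e).const_smul c)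
    · refine ((h3 e).smul c).congr_deriv ?_
      filter_upwards [Lp.coeFn_smul c (p.2 e)] with t ht
      simp only [Prod.smul_snd, PiLp.smul_apply, Pi.neg_apply, Pi.smul_apply] at ht ⊢
      rw [ht, smul_neg]
    · intro h h' hh
      simp [h4.continuous h h' hh]
    · intro v
      rw [← smul_zero c, ← h4.kirchhoff v, Finset.smul_sum]
      refine Finset.sum_congr rfl fun h _ => ?_
      by_cases hb : h.2 = true <;> simp [hb]

/-- The Laplacian `Δ_ℓ` of the metric graph, as an unbounded operator on `L²(|G|)`. -/
noncomputable def laplacian [Fintype E] [DecidableEq V] (G : OrientedGraph V E) (ℓ : E → ℝ) :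
    L2 ℓ →ₗ.[ℂ] L2 ℓ :=
  (G.laplacianGraph ℓ).toLinearPMap

theorem graph_laplacian [Fintype E] [DecidableEq V] (G : OrientedGraph V E) (ℓ : E → ℝ) :
    (G.laplacian ℓ).graph = G.laplacianGraph ℓ := by
  refine Submodule.toLinearPMap_graph_eq _ ?_
  rintro ⟨u, w⟩ ⟨f, f', h1, h2, h3, h4⟩ (rfl : u = 0)
  ext e
  have hf : f e =ᵐ[edgeMeasure (ℓ e)] 0 := (h1 e).symm.trans (Lp.coeFn_zero _ _ _)
  have hw := (h3 e).ae_eq_zero ((h2 e).ae_eq_zero hf)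
  refine EventuallyEq.trans ?_ (Lp.coeFn_zero _ _ _).symm
  filter_upwards [hw] with t ht
  simpa using ht

/-- The function with restriction `a e * cos (k t) + b e * sin (k t)` to each edge `e`
represents `φ`. -/
def HasEdgeForm [Fintype E] {ℓ : E → ℝ} (φ : L2 ℓ) (k : ℝ) (a b : E → ℂ) : Prop :=
  ∀ e, φ e =ᵐ[edgeMeasure (ℓ e)]
    fun t => a e * (Real.cos (k * t) : ℂ) + b e * (Real.sin (k * t) : ℂ)

/-! ### The determinant manifold

On each edge `e` put `φ(t) = a_e cos kt + b_e sin kt` and `θ_e = k ℓ_e`. The unknowns `a_e`, `b_e`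
are indexed by `(e, false)`, `(e, true)`. At a vertex of degree `d` there are `d - 1` continuity
equations and one Kirchhoff equation, hence `2 #E` equations in all, indexed by half-edges once a
half-edge `root v` has been chosen at each vertex `v`. A different choice multiplies
the determinant by a nonzero constant. -/

/-- Coefficients of the value of `φ` at the end of the half-edge `h`. -/
noncomputable def valueCoeff [DecidableEq E] (θ : E → ℝ) (h c : E × Bool) : ℝ :=
  if c.1 = h.1 then
    (if c.2 then (if h.2 then Real.sin (θ h.1 / 2) else -Real.sin (θ h.1 / 2))
      else Real.cos (θ h.1 / 2))
  else 0

/-- Coefficients of the outgoing derivative of `φ`, divided by `k`, at the end of the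
half-edge `h`. -/
noncomputable def derivCoeff [DecidableEq E] (θ : E → ℝ) (h c : E × Bool) : ℝ :=
  if c.1 = h.1 then
    (if c.2 then (if h.2 then -Real.cos (θ h.1 / 2) else Real.cos (θ h.1 / 2))
      else Real.sin (θ h.1 / 2))
  else 0

/-- The linear system: the row of `root v` is the Kirchhoff equation at `v`, and the row of any other
half-edge `h` at `v` says that `φ` takes the same value at the ends of `h` and `root v`. -/
noncomputable def systemMatrix [Fintype E] [DecidableEq E] [DecidableEq V] (G : OrientedGraph V E)
    (root : V → E × Bool) (θ : E → ℝ) : Matrix (E × Bool) (E × Bool) ℝ :=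
  Matrix.of fun h c =>
    if h = root (G.vert h) then ∑ h' : E × Bool with G.vert h' = G.vert h, derivCoeff θ h' c
    else valueCoeff θ h c - valueCoeff θ (root (G.vert h)) c

/-- The determinant of the system is a function `δ_G` on the torus `(ℝ / 2πℤ)^E`: it does not depend
on the choice of representatives of the angles, see `delta_torusPoint`. -/
noncomputable def delta [Fintype E] [DecidableEq E] [DecidableEq V] (G : OrientedGraph V E)
    (root : V → E × Bool) (θ : E → Real.Angle) : ℝ :=
  (G.systemMatrix root fun e => (θ e).toReal).det

theorem delta_torusPoint [Fintype E] [DecidableEq E] [DecidableEq V] (G : OrientedGraph V E)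
    (root : V → E × Bool) (x : E → ℝ) :
    G.delta root (torusPoint x) = (G.systemMatrix root x).det := by
  have hn : ∀ e, ∃ n : ℤ, (x e : Real.Angle).toReal = x e + n * (2 * Real.pi) := by
    intro e
    obtain ⟨n, hn⟩ := Real.Angle.angle_eq_iff_two_pi_dvd_sub.1 (Real.Angle.coe_toReal (x e))
    exact ⟨n, by linarith⟩
  choose n hn using hn
  have hM : G.systemMatrix root (fun e => (torusPoint x e).toReal) =
      G.systemMatrix root x *
        Matrix.diagonal (fun c : E × Bool => ((-1 : ℝ) ^ (n c.1) : ℝ)) := by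
    have hs : ∀ e, Real.sin ((torusPoint x e).toReal / 2) =
        Real.sin (x e / 2) * (-1 : ℝ) ^ (n e) := by
      intro e
      rw [torusPoint, hn e, show (x e + n e * (2 * Real.pi)) / 2 = x e / 2 + n e * Real.pi by ring,
        Real.sin_add_int_mul_pi, mul_comm]
    have hc : ∀ e, Real.cos ((torusPoint x e).toReal / 2) =
        Real.cos (x e / 2) * (-1 : ℝ) ^ (n e) := by
      intro e
      rw [torusPoint, hn e, show (x e + n e * (2 * Real.pi)) / 2 = x e / 2 + n e * Real.pi by ring,
        Real.cos_add_int_mul_pi, mul_comm]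
    have hv : ∀ h c, valueCoeff (fun e => (torusPoint x e).toReal) h c =
        valueCoeff x h c * (-1 : ℝ) ^ (n c.1) := by
      intro h c
      unfold valueCoeff
      split_ifs with h1 <;> simp [hs, hc, h1]
    have hd : ∀ h c, derivCoeff (fun e => (torusPoint x e).toReal) h c =
        derivCoeff x h c * (-1 : ℝ) ^ (n c.1) := by
      intro h c
      unfold derivCoeff
      split_ifs with h1 <;> simp [hs, hc, h1]
    ext h c
    rw [Matrix.mul_diagonal]
    simp only [systemMatrix, Matrix.of_apply, hv, hd]
    split_ifs
    · rw [Finset.sum_mul]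
    · ring
  rw [delta, hM, Matrix.det_mul, Matrix.det_diagonal, Fintype.prod_prod_type]
  have : ∀ e, ∏ _b : Bool, ((-1 : ℝ) ^ (n e)) = 1 := by
    intro e
    rw [Fintype.prod_bool, ← zpow_add₀ (by norm_num), ← two_mul, zpow_mul]
    norm_num
  simp only [this, Finset.prod_const_one, mul_one]

/-- The differential of `δ_G` at the point `p` of the torus. -/
noncomputable def diffDelta [Fintype E] [DecidableEq E] [DecidableEq V] (G : OrientedGraph V E)
    (root : V → E × Bool) (p : E → Real.Angle) : (E → ℝ) →L[ℝ] ℝ :=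
  fderiv ℝ (fun v : E → ℝ => G.delta root (p + torusPoint v)) 0

theorem contDiff_delta [Fintype E] [DecidableEq E] [DecidableEq V] (G : OrientedGraph V E)
    (root : V → E × Bool) (p : E → Real.Angle) :
    ContDiff ℝ ∞ (fun v : E → ℝ => G.delta root (p + torusPoint v)) := by
  have h : (fun v : E → ℝ => G.delta root (p + torusPoint v)) =
      fun v => (G.systemMatrix root ((fun e => (p e).toReal) + v)).det := by
    funext v
    rw [← delta_torusPoint]
    congr 1
    funext e
    simp [torusPoint]
  rw [h]
  simp only [Matrix.det_apply]
  refine ContDiff.sum fun σ _ => ContDiff.const_smul _ (contDiff_prod fun i _ => ?_)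
  simp only [systemMatrix, Matrix.of_apply, valueCoeff, derivCoeff, Pi.add_apply]
  by_cases hr : σ i = root (G.vert (σ i))
  · simp only [if_pos hr]
    refine ContDiff.sum fun j _ => ?_
    split_ifs <;> fun_prop
  · simp only [if_neg hr]
    refine ContDiff.sub ?_ ?_ <;> split_ifs <;> fun_prop

/-- The determinant manifold `Z_G`. -/
def detManifold [Fintype E] [DecidableEq E] [DecidableEq V] (G : OrientedGraph V E)
    (root : V → E × Bool) : Set (E → Real.Angle) :=
  {p | G.delta root p = 0}

/-- The smooth points of `Z_G`. -/
def smoothPoints [Fintype E] [DecidableEq E] [DecidableEq V] (G : OrientedGraph V E)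
    (root : V → E × Bool) : Set (E → Real.Angle) :=
  {p ∈ G.detManifold root | G.diffDelta root p ≠ 0}

/-- The singular points of `Z_G`. -/
def singularPoints [Fintype E] [DecidableEq E] [DecidableEq V] (G : OrientedGraph V E)
    (root : V → E × Bool) : Set (E → Real.Angle) :=
  G.detManifold root \ G.smoothPoints root

end OrientedGraph

/-!
On an edge the eigenfunctions for `k²` are `a cos kt + b sin kt`, and the vertex conditions turn into
the linear system with matrix `M(θ)`, `θ = kℓ`. So the multiplicity of `k²` is the dimension of the
kernel of `M(θ)` (`OrientedGraph.eigenspace_laplacian`, `OrientedGraph.rank_eigenspace`).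

The self-adjointness of the vertex conditions enters through a second matrix `N(θ)`
(`OrientedGraph.conjMatrix`), for which `M(θ + v) = M(θ) cos (v/2) + N(θ) sin (v/2)`, the product
`M Nᵀ` is symmetric and `M Mᵀ + N Nᵀ` is positive definite and constant. Hence `Nᵀ` maps the left
kernel of `M` isomorphically onto the kernel of `M`, and for `y` in the left kernel, `x` in the
kernel and `z = Nᵀ y` the derivative of `yᵀ M x` in the direction `v` is
`(1/2) ∑ₑ vₑ (z_{e,0} x_{e,0} + z_{e,1} x_{e,1})`.

If the kernel of `M` is spanned by `x`, the adjugate of `M` has the form `x yᵀ` with a nonzero `y` in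
the left kernel, and Jacobi's formula shows that the differential of `det M` is a nonzero multiple
of `∑ₑ (x_{e,0}² + x_{e,1}²) dθₑ` (`OrientedGraph.exists_diffDelta_eq`). If the kernel has dimension
at least two, the adjugate vanishes. This gives the smooth and the singular points, and the tangent
space follows from the implicit function theorem.

For the codimension, let `n` be the number of edges. The determinantal set has dimension at least
`n - 1` near each of its points: on lines of direction `(1, …, 1)` the determinant is a polynomial
in `exp (i s)` all of whose roots have modulus one, so zeros persist when the line moves
(`OrientedGraph.eventually_exists_det_eq_zero`). The singular set has dimension at most `n - 2`, by a
distinction of two cases at a singular point with kernel `K`.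

* If two of the vectors `(z_{e,0} x_{e,0} + z_{e,1} x_{e,1})ₑ`, with `x, z ∈ K`, are linearly
  independent, the condition that the dimension of the kernel stays the same is contained in two
  equations with independent differentials
  (`OrientedGraph.exists_nhdsWithin_dimH_le_of_massVec`).
* Otherwise there are two elements of `K` which are the real and imaginary parts of a map from the
  graph to the unit circle that has speed one on every edge. The Kirchhoff condition says that the
  directions in which it turns orient the graph with as many incoming as outgoing edges at each
  vertex, and `θ` is, modulo `2π`, the coboundary of a function on the vertices. There are countably
  many affine spaces of such `θ`, of dimension less than the number of vertices. This number is at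
  most `n - 1` unless each vertex has one incoming and one outgoing edge, in which case the connected
  graph is a circle (`OrientedGraph.Connected.nonempty_realization_homeomorph_circle`).
-/

namespace OrientedGraph

variable {V E : Type*}

/-! ### Boundary data of the solutions on the edges -/

/-- The value, at the end of the half-edge `h`, of the function `x (e, false) * cos (k t) +
x (e, true) * sin (k t)` on the edges of lengths `θ e / k`. -/
noncomputable def endValue {W : Type*} [AddCommGroup W] [Module ℝ W] (θ : E → ℝ)
    (x : E × Bool → W) (h : E × Bool) : W :=
  Real.cos (θ h.1 / 2) • x (h.1, false) +
    (if h.2 then Real.sin (θ h.1 / 2) else -Real.sin (θ h.1 / 2)) • x (h.1, true)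

/-- The outgoing derivative divided by `k`, at the end of the half-edge `h`, of the function
`x (e, false) * cos (k t) + x (e, true) * sin (k t)` on the edges of lengths `θ e / k`. -/
noncomputable def endSlope {W : Type*} [AddCommGroup W] [Module ℝ W] (θ : E → ℝ)
    (x : E × Bool → W) (h : E × Bool) : W :=
  Real.sin (θ h.1 / 2) • x (h.1, false) +
    (if h.2 then -Real.cos (θ h.1 / 2) else Real.cos (θ h.1 / 2)) • x (h.1, true)

/-- The matrix of the boundary data at an end of an edge, in terms of the coefficients, is
orthogonal. -/
theorem endValue_mul_add_endSlope_mul (θ : E → ℝ) (x z : E × Bool → ℝ) (h : E × Bool) :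
    endValue θ x h * endValue θ z h + endSlope θ x h * endSlope θ z h =
      x (h.1, false) * z (h.1, false) + x (h.1, true) * z (h.1, true) := by
  have := Real.sin_sq_add_cos_sq (θ h.1 / 2)
  obtain ⟨e, b⟩ := h
  cases b <;> simp only [endValue, endSlope, smul_eq_mul, if_true, Bool.false_eq_true, if_false] <;>
    linear_combination (x (e, false) * z (e, false) + x (e, true) * z (e, true)) * this

variable [Fintype E] [DecidableEq E]

theorem sum_valueCoeff_smul {W : Type*} [AddCommGroup W] [Module ℝ W] (θ : E → ℝ)
    (x : E × Bool → W) (h : E × Bool) :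
    ∑ c, valueCoeff θ h c • x c = endValue θ x h := by
  rw [Fintype.sum_prod_type]
  simp only [valueCoeff, Fintype.sum_bool, endValue, ite_smul, zero_smul]
  simp only [if_true, Bool.false_eq_true, if_false, Finset.sum_add_distrib, Finset.sum_ite_eq',
    Finset.mem_univ]
  exact add_comm _ _

theorem sum_derivCoeff_smul {W : Type*} [AddCommGroup W] [Module ℝ W] (θ : E → ℝ)
    (x : E × Bool → W) (h : E × Bool) :
    ∑ c, derivCoeff θ h c • x c = endSlope θ x h := by
  rw [Fintype.sum_prod_type]
  simp only [derivCoeff, Fintype.sum_bool, endSlope, ite_smul, zero_smul]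
  simp only [if_true, Bool.false_eq_true, if_false, Finset.sum_add_distrib, Finset.sum_ite_eq',
    Finset.mem_univ]
  exact add_comm _ _

variable [DecidableEq V] (G : OrientedGraph V E) (root : V → E × Bool)

/-- The solutions of the linear system are the coefficient vectors of the functions which are
continuous at the vertices and satisfy the Kirchhoff condition. -/
theorem systemMatrix_smul_eq_zero_iff {W : Type*} [AddCommGroup W] [Module ℝ W]
    (hroot : ∀ v, G.vert (root v) = v) (θ : E → ℝ) (x : E × Bool → W) :
    (∀ h, ∑ c, G.systemMatrix root θ h c • x c = 0) ↔
      (∀ h h', G.vert h = G.vert h' → endValue θ x h = endValue θ x h') ∧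
      ∀ v, ∑ h : E × Bool with G.vert h = v, endSlope θ x h = 0 := by
  have key : ∀ h, ∑ c, G.systemMatrix root θ h c • x c =
      if h = root (G.vert h) then ∑ h' : E × Bool with G.vert h' = G.vert h, endSlope θ x h'
      else endValue θ x h - endValue θ x (root (G.vert h)) := by
    intro h
    simp only [systemMatrix, Matrix.of_apply]
    split_ifs with hh
    · simp only [Finset.sum_smul]
      rw [Finset.sum_comm]
      exact Finset.sum_congr rfl fun h' _ => sum_derivCoeff_smul θ x h'
    · simp only [sub_smul, Finset.sum_sub_distrib, sum_valueCoeff_smul]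
  simp only [key]
  constructor
  · intro H
    have h1 : ∀ h, endValue θ x h = endValue θ x (root (G.vert h)) := by
      intro h
      by_cases hh : h = root (G.vert h)
      · rw [← hh]
      · have := H h
        rw [if_neg hh] at this
        exact sub_eq_zero.1 this
    refine ⟨fun h h' hv => by rw [h1 h, h1 h', hv], fun v => ?_⟩
    have := H (root v)
    rwa [hroot, if_pos rfl] at this
  · rintro ⟨h1, h2⟩ h
    split_ifs with hh
    · exact h2 _
    · rw [h1 h (root (G.vert h)) (hroot _).symm, sub_self]

/-! ### The symplectic structure of the linear system -/

/-- The derivative of the system matrix along the diagonal, multiplied by two: the boundary values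
are replaced by the outgoing derivatives, with a sign, and the outgoing derivatives by the boundary
values. -/
noncomputable def conjMatrix (θ : E → ℝ) : Matrix (E × Bool) (E × Bool) ℝ :=
  Matrix.of fun h c =>
    if h = root (G.vert h) then ∑ h' : E × Bool with G.vert h' = G.vert h, valueCoeff θ h' c
    else -(derivCoeff θ h c - derivCoeff θ (root (G.vert h)) c)

theorem valueCoeff_add {E : Type*} [DecidableEq E] (θ v : E → ℝ) (h c : E × Bool) :
    valueCoeff (θ + v) h c =
      valueCoeff θ h c * Real.cos (v c.1 / 2) - derivCoeff θ h c * Real.sin (v c.1 / 2) := by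
  unfold valueCoeff derivCoeff
  by_cases hc : c.1 = h.1
  · simp only [hc, if_true, Pi.add_apply, add_div, Real.sin_add, Real.cos_add]
    split_ifs <;> ring
  · simp [hc]

theorem derivCoeff_add {E : Type*} [DecidableEq E] (θ v : E → ℝ) (h c : E × Bool) :
    derivCoeff (θ + v) h c =
      derivCoeff θ h c * Real.cos (v c.1 / 2) + valueCoeff θ h c * Real.sin (v c.1 / 2) := by
  unfold valueCoeff derivCoeff
  by_cases hc : c.1 = h.1
  · simp only [hc, if_true, Pi.add_apply, add_div, Real.sin_add, Real.cos_add]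
    split_ifs <;> ring
  · simp [hc]

theorem systemMatrix_add (θ v : E → ℝ) (h c : E × Bool) :
    G.systemMatrix root (θ + v) h c = G.systemMatrix root θ h c * Real.cos (v c.1 / 2) +
      G.conjMatrix root θ h c * Real.sin (v c.1 / 2) := by
  simp only [systemMatrix, conjMatrix, Matrix.of_apply, valueCoeff_add, derivCoeff_add]
  split_ifs
  · rw [Finset.sum_add_distrib, Finset.sum_mul, Finset.sum_mul]
  · ring

theorem conjMatrix_add (θ v : E → ℝ) (h c : E × Bool) :
    G.conjMatrix root (θ + v) h c = G.conjMatrix root θ h c * Real.cos (v c.1 / 2) -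
      G.systemMatrix root θ h c * Real.sin (v c.1 / 2) := by
  simp only [systemMatrix, conjMatrix, Matrix.of_apply, valueCoeff_add, derivCoeff_add]
  split_ifs
  · rw [Finset.sum_sub_distrib, Finset.sum_mul, Finset.sum_mul]
  · ring

/-- The coefficients with which the boundary values enter the equations. -/
def valueRows : Matrix (E × Bool) (E × Bool) ℝ :=
  Matrix.of fun h h' => if h = root (G.vert h) then 0 else
    (if h = h' then 1 else 0) - (if root (G.vert h) = h' then 1 else 0)

/-- The coefficients with which the outgoing derivatives enter the equations. -/
def slopeRows : Matrix (E × Bool) (E × Bool) ℝ :=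
  Matrix.of fun h h' => if h = root (G.vert h) then (if G.vert h' = G.vert h then 1 else 0) else 0

theorem systemMatrix_eq (θ : E → ℝ) :
    G.systemMatrix root θ = G.valueRows root * Matrix.of (valueCoeff θ) +
      G.slopeRows root * Matrix.of (derivCoeff θ) := by
  ext h c
  simp only [systemMatrix, Matrix.add_apply, Matrix.mul_apply, valueRows, slopeRows,
    Matrix.of_apply]
  split_ifs
  · simp [Finset.sum_filter]
  · simp [sub_mul]

theorem conjMatrix_eq (θ : E → ℝ) :
    G.conjMatrix root θ = -(G.valueRows root * Matrix.of (derivCoeff θ)) +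
      G.slopeRows root * Matrix.of (valueCoeff θ) := by
  ext h c
  simp only [conjMatrix, Matrix.add_apply, Matrix.neg_apply, Matrix.mul_apply, valueRows,
    slopeRows, Matrix.of_apply]
  split_ifs
  · simp [Finset.sum_filter]
  · simp [sub_mul]

open Matrix

theorem valueCoeff_mul_transpose_add (θ : E → ℝ) :
    Matrix.of (valueCoeff θ) * (Matrix.of (valueCoeff θ))ᵀ +
      Matrix.of (derivCoeff θ) * (Matrix.of (derivCoeff θ))ᵀ = (2 : ℝ) • 1 := by
  ext ⟨e, b⟩ ⟨e', b'⟩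
  simp only [Matrix.add_apply, Matrix.mul_apply, Matrix.transpose_apply, Matrix.of_apply,
    Matrix.smul_apply, Matrix.one_apply]
  have h1 := sum_valueCoeff_smul θ (fun c => valueCoeff θ (e', b') c) (e, b)
  have h2 := sum_derivCoeff_smul θ (fun c => derivCoeff θ (e', b') c) (e, b)
  simp only [smul_eq_mul] at h1 h2
  rw [h1, h2]
  simp only [endValue, endSlope, valueCoeff, derivCoeff, smul_eq_mul]
  by_cases he : e = e'
  · subst he
    have := Real.sin_sq_add_cos_sq (θ e / 2)
    cases b <;> cases b' <;> simp <;> linarith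
  · simp [he]

theorem valueCoeff_mul_derivCoeff_transpose (θ : E → ℝ) :
    Matrix.of (valueCoeff θ) * (Matrix.of (derivCoeff θ))ᵀ =
      Matrix.of (derivCoeff θ) * (Matrix.of (valueCoeff θ))ᵀ := by
  ext ⟨e, b⟩ ⟨e', b'⟩
  simp only [Matrix.mul_apply, Matrix.transpose_apply, Matrix.of_apply]
  have h1 := sum_valueCoeff_smul θ (fun c => derivCoeff θ (e', b') c) (e, b)
  have h2 := sum_derivCoeff_smul θ (fun c => valueCoeff θ (e', b') c) (e, b)
  simp only [smul_eq_mul] at h1 h2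
  rw [h1, h2]
  simp only [endValue, endSlope, valueCoeff, derivCoeff, smul_eq_mul]
  by_cases he : e = e'
  · subst he
    cases b <;> cases b' <;> simp <;> ring
  · simp [he]

theorem valueRows_mul_slopeRows_transpose (hroot : ∀ v, G.vert (root v) = v) :
    G.valueRows root * (G.slopeRows root)ᵀ = 0 := by
  ext h g
  simp only [Matrix.mul_apply, Matrix.transpose_apply, Matrix.zero_apply, valueRows, slopeRows,
    Matrix.of_apply]
  by_cases hh : h = root (G.vert h)
  · simp [if_pos hh]
  by_cases hg : g = root (G.vert g)
  · simp only [if_neg hh, if_pos hg, sub_mul, ite_mul, one_mul, zero_mul, Finset.sum_sub_distrib,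
      Finset.sum_ite_eq, Finset.mem_univ, if_true, hroot, sub_self]
  · simp [if_neg hg]

theorem slopeRows_mul_valueRows_transpose (hroot : ∀ v, G.vert (root v) = v) :
    G.slopeRows root * (G.valueRows root)ᵀ = 0 := by
  have := congrArg Matrix.transpose (G.valueRows_mul_slopeRows_transpose root hroot)
  simpa [Matrix.transpose_mul] using this

/-- The self-adjointness of the vertex conditions: the product is a symmetric matrix. -/
theorem systemMatrix_mul_conjMatrix_transpose (hroot : ∀ v, G.vert (root v) = v) (θ : E → ℝ) :
    G.systemMatrix root θ * (G.conjMatrix root θ)ᵀ =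
      G.conjMatrix root θ * (G.systemMatrix root θ)ᵀ := by
  rw [systemMatrix_eq, conjMatrix_eq]
  have hPQ := G.valueRows_mul_slopeRows_transpose root hroot
  have hQP := G.slopeRows_mul_valueRows_transpose root hroot
  have hAB := valueCoeff_mul_derivCoeff_transpose θ
  have h2 := valueCoeff_mul_transpose_add θ
  generalize G.valueRows root = P at *
  generalize G.slopeRows root = Q at *
  generalize Matrix.of (valueCoeff θ) = A at *
  generalize Matrix.of (derivCoeff θ) = B at *
  have hA : A * Aᵀ = (2 : ℝ) • 1 - B * Bᵀ := eq_sub_of_add_eq h2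
  have e1 : P * A * (Aᵀ * Qᵀ) = -(P * B * (Bᵀ * Qᵀ)) := by
    rw [Matrix.mul_assoc, ← Matrix.mul_assoc A, hA]
    simp [Matrix.sub_mul, Matrix.mul_sub, hPQ, Matrix.mul_assoc]
  have e2 : Q * A * (Aᵀ * Pᵀ) = -(Q * B * (Bᵀ * Pᵀ)) := by
    rw [Matrix.mul_assoc, ← Matrix.mul_assoc A, hA]
    simp [Matrix.sub_mul, Matrix.mul_sub, hQP, Matrix.mul_assoc]
  have e3 : ∀ X Y : Matrix (E × Bool) (E × Bool) ℝ, X * A * (Bᵀ * Y) = X * B * (Aᵀ * Y) := by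
    intro X Y
    rw [Matrix.mul_assoc, ← Matrix.mul_assoc A, hAB]
    simp only [Matrix.mul_assoc]
  simp only [Matrix.transpose_add, Matrix.transpose_neg, Matrix.transpose_mul, Matrix.mul_add,
    Matrix.add_mul, Matrix.mul_neg, Matrix.neg_mul, e1, e2, e3]
  abel

/-- The sum of squares of the system matrix and of its conjugate does not depend on `θ`. -/
theorem systemMatrix_mul_transpose_add (θ : E → ℝ) :
    G.systemMatrix root θ * (G.systemMatrix root θ)ᵀ +
      G.conjMatrix root θ * (G.conjMatrix root θ)ᵀ =
      (2 : ℝ) • (G.valueRows root * (G.valueRows root)ᵀ +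
        G.slopeRows root * (G.slopeRows root)ᵀ) := by
  rw [systemMatrix_eq, conjMatrix_eq]
  have hAB := valueCoeff_mul_derivCoeff_transpose θ
  have h2 := valueCoeff_mul_transpose_add θ
  generalize G.valueRows root = P at *
  generalize G.slopeRows root = Q at *
  generalize Matrix.of (valueCoeff θ) = A at *
  generalize Matrix.of (derivCoeff θ) = B at *
  have hA : A * Aᵀ = (2 : ℝ) • 1 - B * Bᵀ := eq_sub_of_add_eq h2
  have e1 : ∀ X Y : Matrix (E × Bool) (E × Bool) ℝ,
      X * A * (Aᵀ * Y) = (2 : ℝ) • (X * Y) - X * B * (Bᵀ * Y) := by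
    intro X Y
    rw [Matrix.mul_assoc, ← Matrix.mul_assoc A, hA]
    simp [Matrix.sub_mul, Matrix.mul_sub, Matrix.mul_assoc]
  have e3 : ∀ X Y : Matrix (E × Bool) (E × Bool) ℝ, X * A * (Bᵀ * Y) = X * B * (Aᵀ * Y) := by
    intro X Y
    rw [Matrix.mul_assoc, ← Matrix.mul_assoc A, hAB]
    simp only [Matrix.mul_assoc]
  simp only [Matrix.transpose_add, Matrix.transpose_neg, Matrix.transpose_mul, Matrix.mul_add,
    Matrix.add_mul, Matrix.mul_neg, Matrix.neg_mul, e1, e3, smul_add]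
  abel

/-- The rows of the block matrix `(valueRows, slopeRows)` are linearly independent. -/
theorem eq_zero_of_vecMul_valueRows_slopeRows {y : E × Bool → ℝ}
    (hroot : ∀ v, G.vert (root v) = v)
    (h1 : y ᵥ* G.valueRows root = 0) (h2 : y ᵥ* G.slopeRows root = 0) : y = 0 := by
  have hr : ∀ v, y (root v) = 0 := by
    intro v
    have := congrFun h2 (root v)
    simp only [Matrix.vecMul, dotProduct, slopeRows, Matrix.of_apply, hroot, Pi.zero_apply] at this
    rw [← this, Finset.sum_eq_single (root v)]
    · simp [hroot]
    · intro h _ hne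
      by_cases hh : h = root (G.vert h)
      · rw [if_pos hh, if_neg, mul_zero]
        rintro rfl
        exact hne hh
      · simp [if_neg hh]
    · simp
  funext h
  by_cases hh : h = root (G.vert h)
  · rw [hh]; exact hr _
  have := congrFun h1 h
  simp only [Matrix.vecMul, dotProduct, valueRows, Matrix.of_apply, Pi.zero_apply] at this
  rw [Pi.zero_apply, ← this, Finset.sum_eq_single h]
  · rw [if_neg hh, if_pos rfl, if_neg fun h' => hh h'.symm]; simp
  · intro g _ hg
    by_cases hgr : g = root (G.vert g)
    · rw [if_pos hgr, mul_zero]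
    · rw [if_neg hgr, if_neg hg, if_neg]
      · simp
      · intro h'
        apply hh
        rw [← h', hroot]
  · simp

end OrientedGraph

/-! ### Determinants and singular matrices -/

section Matrices

open Matrix

variable {ι : Type*} [Fintype ι] [DecidableEq ι]

/-- Jacobi's formula for the derivative of a determinant. -/
theorem Matrix.hasStrictFDerivAt_det {W : Type*} [NormedAddCommGroup W] [NormedSpace ℝ W]
    {A : W → Matrix ι ι ℝ} {A' : ι → ι → W →L[ℝ] ℝ} {w : W}
    (hA : ∀ i j, HasStrictFDerivAt (fun w => A w i j) (A' i j) w) :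
    HasStrictFDerivAt (fun w => (A w).det) (∑ i, ∑ j, (A w).adjugate j i • A' i j) w := by
  let d : ContinuousMultilinearMap ℝ (fun _ : ι => ι → ℝ) ℝ :=
    ⟨(detRowAlternating (n := ι) (R := ℝ)).toMultilinearMap,
      (continuous_id (X := Matrix ι ι ℝ)).matrix_det⟩
  have hA2 : HasStrictFDerivAt (fun w => (A w : ι → ι → ℝ))
      (ContinuousLinearMap.pi fun i => ContinuousLinearMap.pi fun j => A' i j) w :=
    hasStrictFDerivAt_pi.2 fun i => hasStrictFDerivAt_pi.2 fun j => hA i j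
  have := (d.hasStrictFDerivAt (A w)).comp w hA2
  refine this.congr_fderiv ?_
  ext v
  rw [ContinuousLinearMap.comp_apply]
  erw [ContinuousMultilinearMap.linearDeriv_apply]
  simp only [_root_.sum_apply, _root_.smul_apply, smul_eq_mul]
  refine Finset.sum_congr rfl fun i _ => ?_
  change ((A w).updateRow i (fun j => A' i j v)).det = _
  rw [← cramer_transpose_apply, cramer_eq_adjugate_mulVec, ← adjugate_transpose]
  simp [mulVec, dotProduct]

theorem Matrix.adjugate_apply_eq_det_updateCol (A : Matrix ι ι ℝ) (i j : ι) :
    A.adjugate j i = (A.updateCol j (Pi.single i 1)).det := by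
  rw [← cramer_apply, cramer_eq_adjugate_mulVec, mulVec_single_one, col_apply]

/-- If the kernel contains nonzero vectors with a vanishing coordinate, for each coordinate, then
no change of a single column makes the matrix invertible. -/
theorem Matrix.adjugate_eq_zero_of_ker {A : Matrix ι ι ℝ}
    (hA : ∀ j, ∃ x : ι → ℝ, x ≠ 0 ∧ A *ᵥ x = 0 ∧ x j = 0) : A.adjugate = 0 := by
  ext j i
  obtain ⟨x, hx, hAx, hxj⟩ := hA j
  rw [Matrix.zero_apply, adjugate_apply_eq_det_updateCol, ← exists_mulVec_eq_zero_iff]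
  refine ⟨x, hx, ?_⟩
  rw [← hAx]
  funext l
  refine Finset.sum_congr rfl fun m _ => ?_
  by_cases hm : m = j
  · subst hm
    simp [hxj]
  · change A.updateCol j _ l m * x m = A l m * x m
    rw [updateCol_ne hm]

/-- The adjugate of a matrix whose kernel is a line. -/
theorem Matrix.adjugate_eq_of_ker_line {A : Matrix ι ι ℝ} {x : ι → ℝ} (hx : x ≠ 0)
    (hAx : A *ᵥ x = 0) (hA : ∀ z, A *ᵥ z = 0 → ∃ c : ℝ, z = c • x) :
    ∃ q : ι → ℝ, q ≠ 0 ∧ q ᵥ* A = 0 ∧ ∀ i j, A.adjugate j i = x j * q i := by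
  have hdet : A.det = 0 := exists_mulVec_eq_zero_iff.1 ⟨x, hx, hAx⟩
  have hcol : ∀ i, ∃ c : ℝ, A.adjugate.col i = c • x := by
    intro i
    apply hA
    have := congrArg (fun B => B.col i) (mul_adjugate A)
    rw [hdet, zero_smul] at this
    exact this
  choose q hq using hcol
  have hadj : ∀ i j, A.adjugate j i = x j * q i := fun i j => by
    have := congrFun (hq i) j
    simpa [mul_comm] using this
  obtain ⟨j, hj⟩ := Function.ne_iff.1 hx
  refine ⟨q, ?_, ?_, hadj⟩
  · -- Replacing the column `j` by a vector outside the range would give an invertible matrix.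
    rintro rfl
    have hns : ¬ Function.Surjective (A.mulVec) := by
      intro hs
      have hi : Function.Injective A.mulVecLin := LinearMap.injective_iff_surjective.2 hs
      exact hx (hi (by simpa using hAx))
    obtain ⟨w, hw⟩ : ∃ w, ∀ z, A *ᵥ z ≠ w := by simpa [Function.Surjective] using hns
    have hw0 : (A.updateCol j w).det = 0 := by
      rw [← cramer_apply, cramer_eq_adjugate_mulVec, mulVec, dotProduct]
      simp [hadj]
    obtain ⟨z, hz, hz0⟩ := exists_mulVec_eq_zero_iff.2 hw0
    have hz1 : A *ᵥ (Function.update z j 0) = -(z j • w) := by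
      funext l
      have := congrFun hz0 l
      simp only [mulVec, dotProduct, Pi.zero_apply, Pi.neg_apply, Pi.smul_apply, smul_eq_mul] at *
      rw [← Finset.add_sum_erase _ _ (Finset.mem_univ j)] at this ⊢
      rw [updateCol_self] at this
      rw [Function.update_self, mul_zero, zero_add, mul_comm (z j),
        ← eq_neg_of_add_eq_zero_right this]
      refine Finset.sum_congr rfl fun m hm => ?_
      rw [updateCol_ne (Finset.ne_of_mem_erase hm),
        Function.update_of_ne (Finset.ne_of_mem_erase hm)]
    have hzj : z j = 0 := by
      by_contra h
      apply hw (-(z j)⁻¹ • Function.update z j 0)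
      rw [mulVec_smul, hz1, smul_neg, neg_smul, neg_neg, smul_smul, inv_mul_cancel₀ h, one_smul]
    have hz2 : Function.update z j 0 = z := by rw [← hzj, Function.update_eq_self]
    rw [hz2, hzj, zero_smul, neg_zero] at hz1
    obtain ⟨c, rfl⟩ := hA z hz1
    have : c = 0 := by
      have : c * x j = 0 := hzj
      exact (mul_eq_zero.1 this).resolve_right hj
    exact hz (by rw [this, zero_smul])
  · have h2 := adjugate_mul A
    rw [hdet, zero_smul] at h2
    funext m
    have := congrFun (congrFun h2 j) m
    rw [mul_apply] at this
    simp only [hadj, zero_apply, mul_assoc, ← Finset.mul_sum] at this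
    exact (mul_eq_zero.1 this).resolve_left hj

theorem Matrix.rank_fromBlocks_one_zero (K : Type*) [Field K] (r s : ℕ) :
    (fromBlocks 1 0 0 0 : Matrix (Fin r ⊕ Fin s) (Fin r ⊕ Fin s) K).rank = r := by
  classical
  rw [← diagonal_one, ← diagonal_zero, fromBlocks_diagonal, rank_diagonal]
  rw [Fintype.card_subtype, Finset.card_filter, Fintype.sum_sum_type]
  simp

/-- A matrix and its image under an injective homomorphism of fields have the same rank. -/
theorem Matrix.rank_map_of_field {K L : Type*} [Field K] [Field L] (f : K →+* L)
    (A : Matrix ι ι K) : (A.map f).rank = A.rank := by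
  obtain ⟨S, U, e, hS, hU, h⟩ := exists_rank_normal_form A
  have hS' : IsUnit (S.map f).det := by
    rw [← RingHom.mapMatrix_apply, ← RingHom.map_det]
    exact ((isUnit_iff_isUnit_det _).1 hS).map f
  have hU' : IsUnit (U.map f).det := by
    rw [← RingHom.mapMatrix_apply, ← RingHom.map_det]
    exact ((isUnit_iff_isUnit_det _).1 hU).map f
  have hm : S.map f * A.map f * U.map f = (fromBlocks 1 0 0 0).submatrix e e := by
    rw [← Matrix.map_mul, ← Matrix.map_mul, h, ← Matrix.submatrix_map, fromBlocks_map]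
    simp
  rw [← rank_mul_eq_right_of_isUnit_det _ (A.map f) hS',
    ← rank_mul_eq_left_of_isUnit_det _ (S.map f * A.map f) hU', hm, rank_submatrix,
    rank_fromBlocks_one_zero]

/-- For every square matrix there is a perturbation, of rank at most the dimension of the kernel,
that makes it invertible. -/
theorem Matrix.exists_add_det_ne_zero (A : Matrix ι ι ℝ) :
    ∃ R : Matrix ι ι ℝ, R.rank ≤ Module.finrank ℝ (LinearMap.ker A.mulVecLin) ∧ (A + R).det ≠ 0 := by
  set f := A.mulVecLin with hf
  obtain ⟨C, hC⟩ := Submodule.exists_isCompl (LinearMap.range f)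
  obtain ⟨D, hD⟩ := Submodule.exists_isCompl (LinearMap.ker f)
  have hdim : Module.finrank ℝ (LinearMap.ker f) = Module.finrank ℝ C := by
    have h1 := LinearMap.finrank_range_add_finrank_ker f
    have h2 := Submodule.finrank_add_eq_of_isCompl hC
    omega
  let eq : LinearMap.ker f ≃ₗ[ℝ] C := LinearEquiv.ofFinrankEq _ _ hdim
  let p := (LinearMap.ker f).projectionOnto D hD
  let g : (ι → ℝ) →ₗ[ℝ] (ι → ℝ) := C.subtype ∘ₗ eq.toLinearMap ∘ₗ p
  refine ⟨LinearMap.toMatrix' g, ?_, ?_⟩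
  · rw [Matrix.rank, ← toLin'_apply', toLin'_toMatrix']
    calc Module.finrank ℝ (LinearMap.range g) ≤ Module.finrank ℝ C :=
          Submodule.finrank_mono (by
            rintro _ ⟨y, rfl⟩
            exact (eq (p y)).2)
      _ = _ := hdim.symm
  · intro h0
    obtain ⟨x, hx, hx0⟩ := exists_mulVec_eq_zero_iff.2 h0
    have hg : LinearMap.toMatrix' g *ᵥ x = g x := by
      rw [← toLin'_apply, toLin'_toMatrix']
    rw [add_mulVec, hg] at hx0
    have h1 : f x = -g x := eq_neg_of_add_eq_zero_left hx0
    have h2 : f x = 0 := by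
      have hm : f x ∈ LinearMap.range f ⊓ C :=
        ⟨⟨x, rfl⟩, by rw [h1]; exact C.neg_mem (eq (p x)).2⟩
      rwa [hC.inf_eq_bot, Submodule.mem_bot] at hm
    have h3 : g x = 0 := by rw [h2] at h1; simpa using h1.symm
    have h4 : eq (p x) = 0 := Subtype.ext h3
    have h5 : p x = 0 := by simpa using h4
    have h6 : p x = ⟨x, h2⟩ := Submodule.projectionOnto_apply_left hD ⟨x, h2⟩
    rw [h6] at h5
    exact hx (congrArg Subtype.val h5)

end Matrices

namespace OrientedGraph

open Matrix

/-! ### The differential of the determinant -/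

variable {V E : Type*} [Fintype E] [DecidableEq E] [DecidableEq V] (G : OrientedGraph V E)
  (root : V → E × Bool)

/-- The coefficient vectors of the real solutions of the linear system. -/
noncomputable abbrev solutions (θ : E → ℝ) : Submodule ℝ (E × Bool → ℝ) :=
  LinearMap.ker (G.systemMatrix root θ).mulVecLin

theorem mem_solutions {θ : E → ℝ} {x : E × Bool → ℝ} :
    x ∈ G.solutions root θ ↔ G.systemMatrix root θ *ᵥ x = 0 := Iff.rfl

theorem hasStrictFDerivAt_systemMatrix (θ : E → ℝ) (h c : E × Bool) :
    HasStrictFDerivAt (fun θ => G.systemMatrix root θ h c)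
      ((2⁻¹ * G.conjMatrix root θ h c) • ContinuousLinearMap.proj (R := ℝ) (φ := fun _ : E => ℝ) c.1)
      θ := by
  have h1 : HasStrictFDerivAt (fun w : E → ℝ => (w - θ) c.1 / 2)
      ((2⁻¹ : ℝ) • ContinuousLinearMap.proj (R := ℝ) (φ := fun _ : E => ℝ) c.1) θ := by
    have : HasStrictFDerivAt (fun w : E → ℝ => w c.1)
      (ContinuousLinearMap.proj (R := ℝ) (φ := fun _ : E => ℝ) c.1) θ :=
      (ContinuousLinearMap.proj (R := ℝ) (φ := fun _ : E => ℝ) c.1).hasStrictFDerivAt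
    simpa [div_eq_inv_mul] using (this.sub_const (θ c.1)).const_mul (2⁻¹ : ℝ)
  have h2 := (h1.cos.const_mul (G.systemMatrix root θ h c)).add
    (h1.sin.const_mul (G.conjMatrix root θ h c))
  have h3 : (fun θ => G.systemMatrix root θ h c) = fun w =>
      G.systemMatrix root θ h c * Real.cos ((w - θ) c.1 / 2) +
      G.conjMatrix root θ h c * Real.sin ((w - θ) c.1 / 2) := by
    funext w
    rw [← systemMatrix_add, add_sub_cancel]
  rw [h3]
  refine h2.congr_fderiv ?_
  ext v
  simp
  ring

theorem torusPoint_add {E : Type*} (x y : E → ℝ) :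
    torusPoint (x + y) = torusPoint x + torusPoint y := by
  funext e
  simp [torusPoint]

theorem hasFDerivAt_delta (θ : E → ℝ) :
    HasFDerivAt (fun v : E → ℝ => G.delta root (torusPoint θ + torusPoint v))
      (∑ h, ∑ c, (G.systemMatrix root θ).adjugate c h •
        ((2⁻¹ * G.conjMatrix root θ h c) •
          ContinuousLinearMap.proj (R := ℝ) (φ := fun _ : E => ℝ) c.1)) 0 := by
  have h1 := Matrix.hasStrictFDerivAt_det
    (fun h c => G.hasStrictFDerivAt_systemMatrix root θ h c)
  have h2 : HasFDerivAt (fun v : E → ℝ => θ + v) (ContinuousLinearMap.id ℝ (E → ℝ)) 0 :=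
    (hasFDerivAt_id _).const_add θ
  have h3 := HasFDerivAt.comp (f := fun v : E → ℝ => θ + v) (0 : E → ℝ)
    (by simpa using h1.hasFDerivAt) h2
  simp only [← torusPoint_add, delta_torusPoint]
  refine h3.congr_fderiv ?_
  rw [ContinuousLinearMap.comp_id]

theorem diffDelta_apply (θ v : E → ℝ) :
    G.diffDelta root (torusPoint θ) v = ∑ h, ∑ c, (G.systemMatrix root θ).adjugate c h *
        (2⁻¹ * G.conjMatrix root θ h c * v c.1) := by
  rw [diffDelta, (G.hasFDerivAt_delta root θ).fderiv]
  simp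

theorem mem_detManifold_iff (θ : E → ℝ) :
    torusPoint θ ∈ G.detManifold root ↔ G.solutions root θ ≠ ⊥ := by
  change G.delta root _ = 0 ↔ _
  rw [delta_torusPoint, ← exists_mulVec_eq_zero_iff, Submodule.ne_bot_iff]
  simp only [mem_solutions]
  exact exists_congr fun x => and_comm

/-- At a point where the space of solutions has dimension at least two, the determinant vanishes
to second order. -/
theorem diffDelta_eq_zero {θ : E → ℝ} (h : 2 ≤ Module.finrank ℝ (G.solutions root θ)) :
    G.diffDelta root (torusPoint θ) = 0 := by
  have hadj : (G.systemMatrix root θ).adjugate = 0 := by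
    refine adjugate_eq_zero_of_ker fun j => ?_
    let p : G.solutions root θ →ₗ[ℝ] ℝ := LinearMap.proj j ∘ₗ (G.solutions root θ).subtype
    have h1 := LinearMap.finrank_range_add_finrank_ker p
    have h2 : Module.finrank ℝ (LinearMap.range p) ≤ 1 := by
      simpa using Submodule.finrank_le (LinearMap.range p)
    have h3 : LinearMap.ker p ≠ ⊥ := by
      intro hb
      rw [hb, finrank_bot] at h1
      omega
    obtain ⟨x, hx, hx0⟩ := Submodule.ne_bot_iff _ |>.1 h3
    exact ⟨x.1, fun h => hx0 (Subtype.ext h), x.2, hx⟩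
  ext v
  rw [diffDelta_apply, hadj]
  simp

/-- The transpose of the conjugate matrix maps the left kernel of the system matrix to its
kernel. -/
theorem vecMul_conjMatrix_mem_solutions (hroot : ∀ v, G.vert (root v) = v) {θ : E → ℝ}
    {y : E × Bool → ℝ} (hy : y ᵥ* G.systemMatrix root θ = 0) :
    y ᵥ* G.conjMatrix root θ ∈ G.solutions root θ := by
  rw [mem_solutions, ← mulVec_transpose, mulVec_mulVec,
    G.systemMatrix_mul_conjMatrix_transpose root hroot, ← mulVec_mulVec, mulVec_transpose, hy,
    mulVec_zero]

theorem eq_zero_of_vecMul_systemMatrix_conjMatrix (hroot : ∀ v, G.vert (root v) = v) {θ : E → ℝ}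
    {y : E × Bool → ℝ} (hy : y ᵥ* G.systemMatrix root θ = 0)
    (hy' : y ᵥ* G.conjMatrix root θ = 0) : y = 0 := by
  have h1 := congrArg (fun B => y ⬝ᵥ (B *ᵥ y)) (G.systemMatrix_mul_transpose_add root θ)
  have key : ∀ B : Matrix (E × Bool) (E × Bool) ℝ,
      y ⬝ᵥ ((B * Bᵀ) *ᵥ y) = (y ᵥ* B) ⬝ᵥ (y ᵥ* B) := by
    intro B
    rw [← mulVec_mulVec, dotProduct_mulVec, mulVec_transpose]
  simp only [add_mulVec, smul_mulVec, dotProduct_add, dotProduct_smul, key, hy, hy',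
    dotProduct_zero, add_zero, smul_eq_mul] at h1
  have n0 : ∀ u : E × Bool → ℝ, 0 ≤ u ⬝ᵥ u := fun u =>
    Finset.sum_nonneg fun i _ => mul_self_nonneg _
  have n1 := n0 (y ᵥ* G.valueRows root)
  have n2 := n0 (y ᵥ* G.slopeRows root)
  refine G.eq_zero_of_vecMul_valueRows_slopeRows root hroot ?_ ?_
  · exact dotProduct_self_eq_zero.1 (by linarith)
  · exact dotProduct_self_eq_zero.1 (by linarith)

/-- The self-adjointness of the vertex conditions identifies the left kernel of the system matrix
with its kernel. -/
theorem exists_vecMul_conjMatrix_eq (hroot : ∀ v, G.vert (root v) = v) {θ : E → ℝ}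
    {z : E × Bool → ℝ} (hz : z ∈ G.solutions root θ) :
    ∃ y, y ᵥ* G.systemMatrix root θ = 0 ∧ y ᵥ* G.conjMatrix root θ = z := by
  let L := LinearMap.ker (G.systemMatrix root θ)ᵀ.mulVecLin
  have hL : ∀ y ∈ L, y ᵥ* G.systemMatrix root θ = 0 := fun y hy => by
    rw [← mulVec_transpose]; exact hy
  let g : L →ₗ[ℝ] G.solutions root θ :=
    ((G.conjMatrix root θ)ᵀ.mulVecLin ∘ₗ L.subtype).codRestrict _ fun y => by
      have := G.vecMul_conjMatrix_mem_solutions root hroot (hL y.1 y.2)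
      rw [← mulVec_transpose] at this
      exact this
  have hg : Function.Injective g := by
    rw [← LinearMap.ker_eq_bot, LinearMap.ker_eq_bot']
    intro y hy
    refine Subtype.ext (G.eq_zero_of_vecMul_systemMatrix_conjMatrix root hroot (hL y.1 y.2) ?_)
    rw [← mulVec_transpose]
    exact congrArg Subtype.val hy
  have hdim : Module.finrank ℝ L = Module.finrank ℝ (G.solutions root θ) := by
    have h1 := LinearMap.finrank_range_add_finrank_ker (G.systemMatrix root θ)ᵀ.mulVecLin
    have h2 := LinearMap.finrank_range_add_finrank_ker (G.systemMatrix root θ).mulVecLin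
    have h3 := rank_transpose (G.systemMatrix root θ)
    rw [Matrix.rank, Matrix.rank] at h3
    change _ + Module.finrank ℝ L = _ at h1
    change _ + Module.finrank ℝ (G.solutions root θ) = _ at h2
    omega
  obtain ⟨y, hy⟩ := (LinearMap.injective_iff_surjective_of_finrank_eq_finrank hdim).1 hg ⟨z, hz⟩
  refine ⟨y.1, hL y.1 y.2, ?_⟩
  rw [← mulVec_transpose]
  exact congrArg Subtype.val hy

/-- At a point where the space of solutions is a line, the differential of the determinant is
given by the masses on the edges of a solution. -/
theorem exists_diffDelta_eq (hroot : ∀ v, G.vert (root v) = v) {θ : E → ℝ} {x : E × Bool → ℝ}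
    (hx0 : x ≠ 0) (hx : x ∈ G.solutions root θ)
    (hθ : ∀ z ∈ G.solutions root θ, ∃ c : ℝ, z = c • x) :
    ∃ r : ℝ, r ≠ 0 ∧ ∀ v, G.diffDelta root (torusPoint θ) v =
      r * ∑ e, (x (e, false) ^ 2 + x (e, true) ^ 2) * v e := by
  obtain ⟨q, hq0, hq, hadj⟩ := adjugate_eq_of_ker_line hx0 hx hθ
  obtain ⟨c, hc⟩ := hθ _ (G.vecMul_conjMatrix_mem_solutions root hroot hq)
  refine ⟨2⁻¹ * c, mul_ne_zero (by norm_num) ?_, fun v => ?_⟩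
  · rintro rfl
    rw [zero_smul] at hc
    exact hq0 (G.eq_zero_of_vecMul_systemMatrix_conjMatrix root hroot hq hc)
  · rw [diffDelta_apply, Finset.sum_comm]
    have : ∀ d : E × Bool, ∑ h, (G.systemMatrix root θ).adjugate d h *
        (2⁻¹ * G.conjMatrix root θ h d * v d.1) = 2⁻¹ * c * (x d ^ 2 * v d.1) := by
      intro d
      have hd : ∑ h, q h * G.conjMatrix root θ h d = c * x d := congrFun hc d
      calc _ = 2⁻¹ * x d * v d.1 * ∑ h, q h * G.conjMatrix root θ h d := by
            rw [Finset.mul_sum]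
            refine Finset.sum_congr rfl fun h _ => ?_
            rw [hadj]; ring
        _ = _ := by rw [hd]; ring
    simp only [this, Fintype.sum_prod_type, Fintype.sum_bool, ← Finset.mul_sum]
    congr 1
    exact Finset.sum_congr rfl fun e _ => by ring

end OrientedGraph

/-! ### The tangent vectors of a regular level set -/

/-- The implicit function theorem gives a curve of the form `t ↦ t v + ψ(t) w` in the zero set, for
a vector `w` transverse to it. -/
theorem exists_curve_of_fderiv_ne_zero {W : Type*} [NormedAddCommGroup W] [NormedSpace ℝ W]
    {f : W → ℝ} (hf : ContDiff ℝ ∞ f) (hf0 : f 0 = 0) (hd : fderiv ℝ f 0 ≠ 0) {v : W}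
    (hv : fderiv ℝ f 0 v = 0) :
    ∃ γ : ℝ → W, ContDiffAt ℝ ∞ γ 0 ∧ γ 0 = 0 ∧ HasDerivAt γ v 0 ∧
      ∀ᶠ t in 𝓝 (0 : ℝ), f (γ t) = 0 := by
  obtain ⟨w, hw⟩ : ∃ w, fderiv ℝ f 0 w ≠ 0 := by
    by_contra! h
    exact hd (ContinuousLinearMap.ext h)
  set g : ℝ × ℝ → ℝ := fun p => f (p.1 • v + p.2 • w) with hg
  have hgc : ContDiff ℝ ∞ g := by fun_prop
  have hgd : HasFDerivAt g ((ContinuousLinearMap.snd ℝ ℝ ℝ).smulRight (fderiv ℝ f 0 w)) 0 := by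
    have h1 : HasFDerivAt (fun p : ℝ × ℝ => p.1 • v + p.2 • w)
        ((ContinuousLinearMap.fst ℝ ℝ ℝ).smulRight v +
          (ContinuousLinearMap.snd ℝ ℝ ℝ).smulRight w) 0 :=
      ((ContinuousLinearMap.fst ℝ ℝ ℝ).smulRight v +
          (ContinuousLinearMap.snd ℝ ℝ ℝ).smulRight w).hasFDerivAt
    have h2 : HasFDerivAt f (fderiv ℝ f 0) ((0 : ℝ × ℝ).1 • v + (0 : ℝ × ℝ).2 • w) := by
      simpa using (hf.differentiable (by simp) 0).hasFDerivAt
    refine (h2.comp (0 : ℝ × ℝ) h1).congr_fderiv ?_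
    ext <;> simp [hv]
  have hinv : (fderiv ℝ g 0 ∘L .inr ℝ ℝ ℝ).IsInvertible := by
    refine ⟨ContinuousLinearEquiv.unitsEquivAut ℝ (Units.mk0 _ hw), ?_⟩
    rw [hgd.fderiv]
    ext
    simp
  have hca := hgc.contDiffAt (x := (0 : ℝ × ℝ))
  set ψ := hca.implicitFunction (by simp) hinv with hψ
  have hψc : ContDiffAt ℝ ∞ ψ 0 := hca.contDiffAt_implicitFunction (by simp) hinv
  have hψ0 : ψ 0 = 0 := hca.implicitFunction_apply_self (by simp) hinv
  have hψd : HasDerivAt ψ 0 0 := by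
    have := (hca.hasStrictFDerivAt_implicitFunction (by simp) hinv).hasFDerivAt
    have h2 : fderiv ℝ g 0 ∘L .inl ℝ ℝ ℝ = 0 := by
      rw [hgd.fderiv]
      ext
      simp
    rw [h2, ContinuousLinearMap.comp_zero] at this
    simpa using this.hasDerivAt
  refine ⟨fun t => t • v + ψ t • w, by fun_prop, by simp [hψ0], ?_, ?_⟩
  · simpa using ((hasDerivAt_id (0 : ℝ)).smul_const v).fun_add (hψd.smul_const w)
  · have := hca.eventually_apply_implicitFunction (by simp) hinv
    filter_upwards [this] with t ht
    refine ht.trans ?_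
    simp [hg, hf0]

namespace OrientedGraph

theorem tangentVectors_detManifold {V E : Type*} [Fintype E] [DecidableEq E] [DecidableEq V]
    (G : OrientedGraph V E) (root : V → E × Bool) {p : E → Real.Angle}
    (hp : p ∈ G.smoothPoints root) :
    tangentVectors (G.detManifold root) p = {v | G.diffDelta root p v = 0} := by
  have hf := G.contDiff_delta root p
  have hf0 : (fun v : E → ℝ => G.delta root (p + torusPoint v)) 0 = 0 := by
    have : torusPoint (0 : E → ℝ) = 0 := by funext e; simp [torusPoint]
    simp only [this, add_zero]
    exact hp.1
  ext v
  constructor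
  · rintro ⟨γ, -, hγ0, hγ, hZ⟩
    have h1 : HasFDerivAt (fun v : E → ℝ => G.delta root (p + torusPoint v))
        (G.diffDelta root p) (γ 0) := by
      rw [hγ0]
      exact (hf.differentiable (by simp) 0).hasFDerivAt
    have h2 := h1.comp_hasDerivAt (0 : ℝ) hγ
    have h3 : HasDerivAt ((fun v : E → ℝ => G.delta root (p + torusPoint v)) ∘ γ) 0 0 :=
      (hasDerivAt_const (0 : ℝ) (0 : ℝ)).congr_of_eventuallyEq hZ
    exact h2.unique h3
  · intro hv
    exact exists_curve_of_fderiv_ne_zero hf hf0 hp.2 hv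

end OrientedGraph

/-! ### Upper bounds for the Hausdorff dimension -/

section Dimension

open Module

theorem dimH_le_of_locally {X : Type*} [EMetricSpace X] [SecondCountableTopology X] {s : Set X}
    {r : ℝ≥0∞} (h : ∀ x ∈ s, ∃ t ∈ 𝓝[s] x, dimH t ≤ r) : dimH s ≤ r := by
  by_contra! hr
  obtain ⟨x, hx, hxt⟩ := exists_mem_nhdsWithin_lt_dimH_of_lt_dimH hr
  obtain ⟨t, ht, htr⟩ := h x hx
  exact absurd (hxt t ht) (not_lt.2 htr)

/-- A set on which a function with surjective strict derivative at `x` vanishes has, near `x`,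
at most the dimension of the kernel of the derivative: the projection to this kernel is
antilipschitz on the set. -/
theorem exists_nhdsWithin_dimH_le {W F : Type*} [NormedAddCommGroup W] [NormedSpace ℝ W]
    [FiniteDimensional ℝ W] [NormedAddCommGroup F] [NormedSpace ℝ F] {f : W → F} {f' : W →L[ℝ] F}
    {x : W} {s : Set W} (hf : HasStrictFDerivAt f f' x) (hs : ∀ᶠ y in 𝓝[s] x, f y = 0) :
    ∃ t ∈ 𝓝[s] x, dimH t ≤ finrank ℝ (LinearMap.ker f'.toLinearMap) := by
  set K := LinearMap.ker f'.toLinearMap with hK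
  obtain ⟨C, hC⟩ := Submodule.exists_isCompl K
  let p : W →L[ℝ] K := LinearMap.toContinuousLinearMap (K.projectionOnto C hC)
  -- The map `f'` is injective on the kernel of `p`, so `(f', p)` is bounded below.
  let T : W →L[ℝ] F × K := f'.prod p
  have hT : LinearMap.ker T.toLinearMap = ⊥ := by
    rw [LinearMap.ker_eq_bot']
    intro w hw
    have h1 : f' w = 0 := congrArg Prod.fst hw
    have h2 : p w = 0 := congrArg Prod.snd hw
    have h3 : p w = ⟨w, h1⟩ := Submodule.projectionOnto_apply_left hC ⟨w, h1⟩
    rw [h3] at h2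
    exact congrArg Subtype.val h2
  obtain ⟨c, hc, hTc⟩ := LinearMap.exists_antilipschitzWith T.toLinearMap hT
  have hbd : ∀ w, ‖w‖ ≤ c * max ‖f' w‖ ‖p w‖ := fun w => by
    have := hTc.le_mul_dist w 0
    simpa [dist_eq_norm, Prod.norm_def, T] using this
  have hc2 : (0 : ℝ) < 1 / (2 * c) := by positivity
  have hst := hf.isLittleO.bound hc2
  rw [nhds_prod_eq] at hst
  obtain ⟨u, hu, huu⟩ := Filter.eventually_prod_self_iff'.1 hst
  refine ⟨{y | f y = 0} ∩ (s ∩ u), inter_mem hs (inter_mem self_mem_nhdsWithin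
    (mem_nhdsWithin_of_mem_nhds hu)), ?_⟩
  set t := {y | f y = 0} ∩ (s ∩ u) with ht
  have hanti : AntilipschitzWith c (fun y : t => p y) := by
    refine AntilipschitzWith.of_le_mul_dist fun y z => ?_
    have h1 := huu y.1 y.2.2.2 z.1 z.2.2.2
    rw [y.2.1, z.2.1] at h1
    simp only [sub_self, zero_sub, norm_neg] at h1
    have h2 := hbd (y.1 - z.1)
    rw [Subtype.dist_eq, dist_eq_norm, dist_eq_norm, ← map_sub]
    rcases le_total ‖f' (y.1 - z.1)‖ ‖p (y.1 - z.1)‖ with h | h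
    · rwa [max_eq_right h] at h2
    · rw [max_eq_left h] at h2
      have h3 : ‖y.1 - z.1‖ ≤ ‖y.1 - z.1‖ / 2 := by
        calc _ ≤ _ := h2
          _ ≤ c * (1 / (2 * c) * ‖y.1 - z.1‖) := by gcongr
          _ = _ := by field_simp
      have h4 : ‖y.1 - z.1‖ = 0 :=
        le_antisymm (by linarith [norm_nonneg (y.1 - z.1)]) (norm_nonneg _)
      rw [h4]
      positivity
  calc dimH t = dimH (univ : Set t) := by
        have := (isometry_subtype_coe (s := t)).dimH_image univ
        rwa [image_univ, Subtype.range_coe] at this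
    _ ≤ dimH ((fun y : t => p y) '' univ) := hanti.le_dimH_image univ
    _ ≤ dimH (univ : Set K) := dimH_mono (subset_univ _)
    _ = _ := Real.dimH_univ_eq_finrank K

/-- Two functions with linearly independent differentials cut out a set of codimension two. -/
theorem exists_nhdsWithin_dimH_add_two_le {W : Type*} [NormedAddCommGroup W] [NormedSpace ℝ W]
    [FiniteDimensional ℝ W] {f g : W → ℝ} {f' g' : W →L[ℝ] ℝ} {x : W} {s : Set W}
    (hf : HasStrictFDerivAt f f' x) (hg : HasStrictFDerivAt g g' x)
    (hfg : LinearIndependent ℝ ![f', g'])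
    (hs : ∀ᶠ y in 𝓝[s] x, f y = 0) (hs' : ∀ᶠ y in 𝓝[s] x, g y = 0) :
    2 ≤ finrank ℝ W ∧ ∃ t ∈ 𝓝[s] x, dimH t ≤ (finrank ℝ W - 2 : ℕ) := by
  obtain ⟨t, ht, htd⟩ := exists_nhdsWithin_dimH_le (hf.prodMk hg)
    (by filter_upwards [hs, hs'] with y h1 h2; exact Prod.ext h1 h2)
  have hsurj : LinearMap.range (f'.prod g').toLinearMap = ⊤ := by
    by_contra hne
    obtain ⟨φ, hφ, hφr⟩ := Submodule.exists_le_ker_of_lt_top _ (lt_top_iff_ne_top.2 hne)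
    apply hφ
    have h0 : ∀ w, f' w * φ (1, 0) + g' w * φ (0, 1) = 0 := by
      intro w
      have := hφr ⟨w, rfl⟩
      have h2 : ((f'.prod g').toLinearMap w) =
          f' w • ((1 : ℝ), (0 : ℝ)) + g' w • ((0 : ℝ), (1 : ℝ)) := by
        simp
      rw [LinearMap.mem_ker, h2] at this
      simpa only [map_add, map_smul, smul_eq_mul] using this
    have h1 := LinearIndependent.pair_iff.1 hfg (φ (1, 0)) (φ (0, 1)) (by
      ext w
      have := h0 w
      simp
      linarith)
    ext
    · simpa using h1.1
    · simpa using h1.2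
  have hdim := LinearMap.finrank_range_add_finrank_ker (f'.prod g').toLinearMap
  rw [hsurj, finrank_top] at hdim
  simp only [finrank_prod, finrank_self] at hdim
  refine ⟨by omega, t, ht, htd.trans ?_⟩
  norm_cast
  omega

end Dimension

namespace OrientedGraph

open Matrix

/-! ### Points where the space of solutions keeps its dimension -/

/-- The polarized masses of two coefficient vectors on the edges. -/
def massVec {E : Type*} (z x : E × Bool → ℝ) : E → ℝ :=
  fun e => z (e, false) * x (e, false) + z (e, true) * x (e, true)

variable {V E : Type*} [Fintype E] [DecidableEq E] [DecidableEq V] (G : OrientedGraph V E)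
  (root : V → E × Bool)

/-- Every pair of solutions at `θ` gives a function which vanishes near `θ` where the space of
solutions keeps its dimension, and whose differential at `θ` is given by the polarized masses. The
function is a component of `M (M + R)⁻¹ R`, up to a determinant, where `M` is the system matrix and
the constant matrix `R` has rank the dimension of the space of solutions. -/
theorem exists_function_of_solutions (hroot : ∀ v, G.vert (root v) = v) {θ : E → ℝ}
    {z x : E × Bool → ℝ} (hz : z ∈ G.solutions root θ) (hx : x ∈ G.solutions root θ) :
    ∃ (f : (E → ℝ) → ℝ) (f' : (E → ℝ) →L[ℝ] ℝ) (d : ℝ), HasStrictFDerivAt f f' θ ∧ d ≠ 0 ∧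
      (∀ v, f' v = d * ∑ e, massVec z x e * v e) ∧
      ∀ᶠ τ in 𝓝[{τ | Module.finrank ℝ (G.solutions root τ) =
        Module.finrank ℝ (G.solutions root θ)}] θ, f τ = 0 := by
  obtain ⟨y, hy, hyz⟩ := G.exists_vecMul_conjMatrix_eq root hroot hz
  obtain ⟨R, hR, hdet⟩ := Matrix.exists_add_det_ne_zero (G.systemMatrix root θ)
  have hT : ∀ h c, HasStrictFDerivAt (fun τ => (G.systemMatrix root τ + R) h c)
      ((2⁻¹ * G.conjMatrix root θ h c) •
        ContinuousLinearMap.proj (R := ℝ) (φ := fun _ : E => ℝ) c.1) θ := fun h c =>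
    (G.hasStrictFDerivAt_systemMatrix root θ h c).add_const _
  have ha : ∀ c, ∃ a' : (E → ℝ) →L[ℝ] ℝ, HasStrictFDerivAt
      (fun τ => cramer (G.systemMatrix root τ + R) (R *ᵥ x) c) a' θ := by
    intro c
    simp only [cramer_apply]
    have : ∀ i j, ∃ A' : (E → ℝ) →L[ℝ] ℝ, HasStrictFDerivAt
        (fun τ => (G.systemMatrix root τ + R).updateCol c (R *ᵥ x) i j) A' θ := by
      intro i j
      by_cases hj : j = c
      · subst hj
        simp only [updateCol_self]
        exact ⟨0, hasStrictFDerivAt_const _ _⟩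
      · simp only [updateCol_ne hj]
        exact ⟨_, hT i j⟩
    choose A' hA' using this
    exact ⟨_, Matrix.hasStrictFDerivAt_det hA'⟩
  choose a' ha' using ha
  have hL : ∀ c, HasStrictFDerivAt (fun τ => ∑ h, y h * G.systemMatrix root τ h c)
      ((2⁻¹ * z c) • ContinuousLinearMap.proj (R := ℝ) (φ := fun _ : E => ℝ) c.1) θ := by
    intro c
    have := HasStrictFDerivAt.fun_sum (u := Finset.univ) fun h _ =>
      (G.hasStrictFDerivAt_systemMatrix root θ h c).const_mul (y h)
    refine this.congr_fderiv ?_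
    have hzc : ∑ h, y h * G.conjMatrix root θ h c = z c := congrFun hyz c
    ext v
    simp only [_root_.sum_apply, _root_.smul_apply, smul_eq_mul, ← hzc, Finset.mul_sum,
      Finset.sum_mul]
    exact Finset.sum_congr rfl fun h _ => by ring
  have hL0 : ∀ c, ∑ h, y h * G.systemMatrix root θ h c = 0 := fun c => congrFun hy c
  have ha0 : ∀ c, cramer (G.systemMatrix root θ + R) (R *ᵥ x) c =
      (G.systemMatrix root θ + R).det * x c := by
    intro c
    have h1 : R *ᵥ x = (G.systemMatrix root θ + R) *ᵥ x := by
      rw [add_mulVec, (G.mem_solutions root).1 hx, zero_add]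
    rw [h1, cramer_eq_adjugate_mulVec, mulVec_mulVec, adjugate_mul, smul_mulVec, one_mulVec]
    rfl
  have hf := HasStrictFDerivAt.fun_sum (u := Finset.univ) fun c _ => (hL c).mul (ha' c)
  refine ⟨_, _, 2⁻¹ * (G.systemMatrix root θ + R).det, hf, mul_ne_zero (by norm_num) hdet, ?_, ?_⟩
  · intro v
    simp only [_root_.sum_apply, _root_.add_apply, _root_.smul_apply, smul_eq_mul, hL0, ha0,
      zero_mul, zero_add, ContinuousLinearMap.proj_apply, massVec]
    rw [Fintype.sum_prod_type, Finset.mul_sum]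
    refine Finset.sum_congr rfl fun e _ => ?_
    rw [Fintype.sum_bool]
    ring
  · have hev : ∀ᶠ τ in 𝓝 θ, (G.systemMatrix root τ + R).det ≠ 0 :=
      (Matrix.hasStrictFDerivAt_det hT).continuousAt.eventually_ne hdet
    filter_upwards [mem_nhdsWithin_of_mem_nhds hev, self_mem_nhdsWithin] with τ hτ hτS
    set T := G.systemMatrix root τ + R with hTdef
    -- The range of `adjugate T * R` contains the solutions, hence equals them, by dimension.
    have hle : G.solutions root τ ≤ LinearMap.range (T.adjugate * R).mulVecLin := by
      intro w hw
      have h1 : R *ᵥ w = T *ᵥ w := by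
        rw [hTdef, add_mulVec, (G.mem_solutions root).1 hw, zero_add]
      refine ⟨T.det⁻¹ • w, ?_⟩
      rw [mulVecLin_apply, mulVec_smul, ← mulVec_mulVec, h1, mulVec_mulVec, adjugate_mul,
        smul_mulVec, one_mulVec, smul_smul, inv_mul_cancel₀ hτ, one_smul]
    have heq : G.solutions root τ = LinearMap.range (T.adjugate * R).mulVecLin := by
      refine Submodule.eq_of_le_of_finrank_le hle ?_
      rw [hτS]
      exact (rank_mul_le_right T.adjugate R).trans hR
    have hmem : cramer T (R *ᵥ x) ∈ G.solutions root τ := by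
      rw [heq]
      exact ⟨x, by rw [mulVecLin_apply, ← mulVec_mulVec, cramer_eq_adjugate_mulVec]⟩
    have h0 := congrArg (fun u => y ⬝ᵥ u) ((G.mem_solutions root).1 hmem)
    simp only [dotProduct_zero, dotProduct_mulVec] at h0
    exact h0

/-- Near a point with two pairs of solutions of linearly independent polarized masses, the
dimension of the space of solutions is preserved only on a set of codimension two. -/
theorem exists_nhdsWithin_dimH_le_of_massVec (hroot : ∀ v, G.vert (root v) = v) {θ : E → ℝ}
    {z x z' x' : E × Bool → ℝ} (hz : z ∈ G.solutions root θ) (hx : x ∈ G.solutions root θ)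
    (hz' : z' ∈ G.solutions root θ) (hx' : x' ∈ G.solutions root θ)
    (hli : LinearIndependent ℝ ![massVec z x, massVec z' x']) :
    2 ≤ Fintype.card E ∧
    ∃ t ∈ 𝓝[{τ | Module.finrank ℝ (G.solutions root τ) =
        Module.finrank ℝ (G.solutions root θ)}] θ, dimH t ≤ (Fintype.card E - 2 : ℕ) := by
  obtain ⟨f, f', d, hf, hd, hfv, hf0⟩ := G.exists_function_of_solutions root hroot hz hx
  obtain ⟨g, g', d', hg, hd', hgv, hg0⟩ := G.exists_function_of_solutions root hroot hz' hx'
  have := exists_nhdsWithin_dimH_add_two_le hf hg ?_ hf0 hg0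
  · simpa using this
  rw [LinearIndependent.pair_iff] at hli ⊢
  intro s t hst
  have h := hli (s * d) (t * d') (by
    funext e
    have := congrArg (fun L => L (Pi.single e 1)) hst
    simp only [_root_.add_apply, _root_.smul_apply, hfv, hgv, smul_eq_mul, Pi.single_apply,
      mul_ite, mul_one, mul_zero, Finset.sum_ite_eq', Finset.mem_univ, if_true,
      _root_.zero_apply] at this
    simp only [Pi.add_apply, Pi.smul_apply, smul_eq_mul, Pi.zero_apply]
    linarith)
  exact ⟨(mul_eq_zero.1 h.1).resolve_right hd, (mul_eq_zero.1 h.2).resolve_right hd'⟩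

end OrientedGraph

namespace OrientedGraph

/-! ### Solutions with proportional masses -/

/-- The initial vertices of the edges, after a change of orientation. -/
def tail {V E : Type*} (G : OrientedGraph V E) (σ : E → Bool) (e : E) : V :=
  if σ e then G.src e else G.tgt e

/-- The final vertices of the edges, after a change of orientation. -/
def head {V E : Type*} (G : OrientedGraph V E) (σ : E → Bool) (e : E) : V :=
  if σ e then G.tgt e else G.src e

/-- A change of orientation of the edges is balanced if at each vertex there are as many outgoing
as incoming edges. -/
def IsBalanced {V E : Type*} [Fintype E] [DecidableEq V] (G : OrientedGraph V E) (σ : E → Bool) :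
    Prop :=
  ∀ v, (Finset.univ.filter fun e => G.tail σ e = v).card =
    (Finset.univ.filter fun e => G.head σ e = v).card

/-- The lengths for which the edges, oriented by `σ`, can be mapped to the circle of length `2π` by
local isometries that preserve the orientation and agree at the vertices. -/
def circlePoints {V E : Type*} (G : OrientedGraph V E) (σ : E → Bool) : Set (E → ℝ) :=
  {θ | ∃ (φ : V → ℝ) (n : E → ℤ), ∀ e,
    θ e = φ (G.head σ e) - φ (G.tail σ e) + 2 * Real.pi * n e}

theorem Connected.induction {V E : Type*} {G : OrientedGraph V E} (hG : G.Connected) {P : V → Prop}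
    (hP : ∀ e, P (G.src e) ↔ P (G.tgt e)) {v : V} (hv : P v) (w : V) : P w := by
  have hr := (SimpleGraph.reachable_iff_reflTransGen v w).1 (hG.preconnected v w)
  induction hr with
  | refl => exact hv
  | tail _ h ih =>
    rw [SimpleGraph.fromRel_adj] at h
    rcases h.2 with ⟨e, he, he'⟩ | ⟨e, he, he'⟩
    · rw [← he'] ; rw [← he] at ih; exact (hP e).1 ih
    · rw [← he] ; rw [← he'] at ih; exact (hP e).2 ih

section

variable {E : Type*}

theorem massVec_self_ne_zero {x : E × Bool → ℝ} (hx : x ≠ 0) : massVec x x ≠ 0 := by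
  intro h
  apply hx
  funext ⟨e, b⟩
  have := congrFun h e
  simp only [massVec, Pi.zero_apply] at this
  have h1 := mul_self_nonneg (x (e, false))
  have h2 := mul_self_nonneg (x (e, true))
  cases b
  · exact mul_self_eq_zero.1 (by linarith)
  · exact mul_self_eq_zero.1 (by linarith)

theorem massVec_self_nonneg (x : E × Bool → ℝ) (e : E) : 0 ≤ massVec x x e :=
  add_nonneg (mul_self_nonneg _) (mul_self_nonneg _)

theorem massVec_smul_smul (s t : ℝ) (z x : E × Bool → ℝ) :
    massVec (s • z) (t • x) = (s * t) • massVec z x := by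
  funext e
  simp only [massVec, Pi.smul_apply, smul_eq_mul]
  ring

/-- If the polarized masses are all proportional, two solutions that are orthogonal on one edge are
orthogonal on every edge, and solutions with the same mass on one edge have the same masses. -/
theorem exists_orthogonal_of_massVec {K : Submodule ℝ (E × Bool → ℝ)}
    (hK : 2 ≤ Module.finrank ℝ K)
    (hd : ∀ z ∈ K, ∀ x ∈ K, ∀ z' ∈ K, ∀ x' ∈ K,
      ¬ LinearIndependent ℝ ![massVec z x, massVec z' x']) :
    ∃ x ∈ K, ∃ z ∈ K, x ≠ 0 ∧ massVec z z = massVec x x ∧ massVec x z = 0 := by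
  have hKb : K ≠ ⊥ := by
    rintro rfl
    simp at hK
  obtain ⟨x, hx, hx0⟩ := K.ne_bot_iff.1 hKb
  have hμ := massVec_self_ne_zero hx0
  have hprop : ∀ z ∈ K, ∀ w ∈ K, ∃ c : ℝ, c • massVec x x = massVec z w := by
    intro z hz w hw
    have := hd x hx x hx z hz w hw
    rw [LinearIndependent.pair_iff' hμ] at this
    push Not at this
    exact this
  obtain ⟨w, hw, hwx⟩ : ∃ w ∈ K, ∀ c : ℝ, w ≠ c • x := by
    by_contra! h
    have : Module.finrank ℝ K ≤ 1 := finrank_le_one (⟨x, hx⟩ : K) fun w => by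
      obtain ⟨c, hc⟩ := h w.1 w.2
      exact ⟨c, Subtype.ext hc.symm⟩
    omega
  obtain ⟨c, hc⟩ := hprop x hx w hw
  have hz : w - c • x ∈ K := K.sub_mem hw (K.smul_mem c hx)
  have hz0 : w - c • x ≠ 0 := fun h => hwx c (sub_eq_zero.1 h)
  have hxz : massVec x (w - c • x) = 0 := by
    funext e
    have := congrFun hc e
    simp only [massVec, Pi.smul_apply, Pi.sub_apply, smul_eq_mul, Pi.zero_apply] at this ⊢
    linarith
  obtain ⟨t, ht⟩ := hprop _ hz _ hz
  have ht0 : 0 < t := by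
    obtain ⟨e, he⟩ := Function.ne_iff.1 (massVec_self_ne_zero hz0)
    have h1 := massVec_self_nonneg (w - c • x) e
    have h2 := massVec_self_nonneg x e
    rw [← ht] at h1 he
    simp only [Pi.smul_apply, smul_eq_mul, Pi.zero_apply] at h1 he
    by_contra! h
    exact he (le_antisymm (mul_nonpos_of_nonpos_of_nonneg h h2) h1)
  refine ⟨x, hx, (Real.sqrt t)⁻¹ • (w - c • x), K.smul_mem _ hz, hx0, ?_, ?_⟩
  · rw [massVec_smul_smul, ← ht, smul_smul, ← mul_inv, Real.mul_self_sqrt ht0.le,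
      inv_mul_cancel₀ ht0.ne', one_smul]
  · have := massVec_smul_smul 1 (Real.sqrt t)⁻¹ x (w - c • x)
    rw [one_smul, hxz, smul_zero] at this
    exact this

/-- For a square matrix of order two, orthogonality of the rows, with equal norms, implies equality
of the norms of the columns with those of the rows. -/
theorem sq_add_sq_eq_of_orthogonal {a b c d μ : ℝ} (h1 : a * a + b * b = μ) (h2 : c * c + d * d = μ)
    (h3 : a * c + b * d = 0) : a * a + c * c = μ := by
  have h4 : μ * (a * a + c * c - μ) = 0 := by
    linear_combination (μ - c * c) * h1 + b * b * h2 + (a * c - b * d) * h3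
  rcases mul_eq_zero.1 h4 with h | h
  · have := mul_self_nonneg a
    have := mul_self_nonneg b
    have := mul_self_nonneg c
    have := mul_self_nonneg d
    linarith
  · linarith

end

section

variable {V E : Type*} [Fintype E] [DecidableEq E] [DecidableEq V] (G : OrientedGraph V E)
  (root : V → E × Bool)

theorem mem_solutions_iff (hroot : ∀ v, G.vert (root v) = v) {θ : E → ℝ} {x : E × Bool → ℝ} :
    x ∈ G.solutions root θ ↔
      (∀ h h', G.vert h = G.vert h' → endValue θ x h = endValue θ x h') ∧
      ∀ v, ∑ h : E × Bool with G.vert h = v, endSlope θ x h = 0 := by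
  rw [← G.systemMatrix_smul_eq_zero_iff root hroot, mem_solutions, funext_iff]
  rfl

/-- If all the polarized masses of the solutions are proportional, there are two orthogonal
solutions of mass one on every edge. -/
theorem exists_orthonormal_of_massVec (hG : G.Connected) (hroot : ∀ v, G.vert (root v) = v)
    {θ : E → ℝ} (hK : 2 ≤ Module.finrank ℝ (G.solutions root θ))
    (hd : ∀ z ∈ G.solutions root θ, ∀ x ∈ G.solutions root θ, ∀ z' ∈ G.solutions root θ,
      ∀ x' ∈ G.solutions root θ, ¬ LinearIndependent ℝ ![massVec z x, massVec z' x']) :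
    ∃ x ∈ G.solutions root θ, ∃ z ∈ G.solutions root θ,
      massVec x x = 1 ∧ massVec z z = 1 ∧ massVec x z = 0 := by
  obtain ⟨x, hx, z, hz, hx0, hzx, hxz⟩ := exists_orthogonal_of_massVec hK hd
  -- The matrix of the boundary data of `x` and `z` at an end is orthogonal up to a factor, so the
  -- mass on an edge is determined by the boundary values, which depend on the vertex only.
  have hval : ∀ h : E × Bool, endValue θ x h * endValue θ x h + endValue θ z h * endValue θ z h =
      massVec x x h.1 := fun h =>
    sq_add_sq_eq_of_orthogonal (b := endSlope θ x h) (d := endSlope θ z h)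
      (endValue_mul_add_endSlope_mul θ x x h)
      ((endValue_mul_add_endSlope_mul θ z z h).trans (congrFun hzx h.1))
      ((endValue_mul_add_endSlope_mul θ x z h).trans (congrFun hxz h.1))
  have hmass : ∀ h h', G.vert h = G.vert h' → massVec x x h.1 = massVec x x h'.1 := by
    intro h h' hv
    rw [← hval h, ← hval h', ((G.mem_solutions_iff root hroot).1 hx).1 h h' hv,
      ((G.mem_solutions_iff root hroot).1 hz).1 h h' hv]
  obtain ⟨e₀, he₀⟩ := Function.ne_iff.1 (massVec_self_ne_zero hx0)
  have hconst : ∀ e, massVec x x e = massVec x x e₀ := by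
    have := hG.induction (P := fun v => ∀ h, G.vert h = v → massVec x x h.1 = massVec x x e₀)
      (fun e => ?_) (v := G.src e₀) ?_
    · intro e
      exact this (G.src e) (e, false) rfl
    · constructor
      · intro h h' hh'
        exact (hmass h' (e, true) hh').trans (h (e, false) rfl)
      · intro h h' hh'
        exact (hmass h' (e, false) hh').trans (h (e, true) rfl)
    · intro h hh
      exact hmass h (e₀, false) hh
  set m := massVec x x e₀ with hm
  have hm0 : 0 < m := lt_of_le_of_ne (massVec_self_nonneg x e₀) (Ne.symm he₀)
  have hscale : massVec ((Real.sqrt m)⁻¹ • x) ((Real.sqrt m)⁻¹ • x) = 1 := by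
    funext e
    rw [massVec_smul_smul, Pi.smul_apply, hconst, smul_eq_mul, ← mul_inv,
      Real.mul_self_sqrt hm0.le, inv_mul_cancel₀ hm0.ne', Pi.one_apply]
  refine ⟨(Real.sqrt m)⁻¹ • x, Submodule.smul_mem _ _ hx, (Real.sqrt m)⁻¹ • z,
    Submodule.smul_mem _ _ hz, hscale, ?_, ?_⟩
  · rw [massVec_smul_smul, hzx, ← massVec_smul_smul, hscale]
  · rw [massVec_smul_smul, hxz, smul_zero]

/-- Two orthogonal solutions of mass one on every edge are the real and imaginary parts of a map
to the unit circle which is a local isometry on every edge; the directions in which it turns give a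
balanced orientation. -/
theorem exists_isBalanced_of_orthonormal (hroot : ∀ v, G.vert (root v) = v) {θ : E → ℝ}
    {x z : E × Bool → ℝ} (hx : x ∈ G.solutions root θ) (hz : z ∈ G.solutions root θ)
    (hxx : massVec x x = 1) (hzz : massVec z z = 1) (hxz : massVec x z = 0) :
    ∃ σ : E → Bool, G.IsBalanced σ ∧ θ ∈ G.circlePoints σ := by
  rw [G.mem_solutions_iff root hroot] at hx hz
  have e1 : ∀ e, x (e, false) * x (e, false) + x (e, true) * x (e, true) = 1 := congrFun hxx
  have e2 : ∀ e, z (e, false) * z (e, false) + z (e, true) * z (e, true) = 1 := congrFun hzz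
  have e3 : ∀ e, x (e, false) * z (e, false) + x (e, true) * z (e, true) = 0 := congrFun hxz
  -- On the edge `e` the map `x + i z` is a multiple of `exp (i ε t)`.
  set ε : E → ℝ := fun e => x (e, false) * z (e, true) - x (e, true) * z (e, false) with hε
  have hx1 : ∀ e, x (e, true) = -(ε e * z (e, false)) := fun e => by
    simp only [hε]
    linear_combination (-x (e, true)) * e2 e + z (e, true) * e3 e
  have hz1 : ∀ e, z (e, true) = ε e * x (e, false) := fun e => by
    simp only [hε]
    linear_combination (-z (e, true)) * e1 e + x (e, true) * e3 e
  have hnorm : ∀ e, x (e, false) * x (e, false) + z (e, false) * z (e, false) = 1 := fun e =>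
    sq_add_sq_eq_of_orthogonal (e1 e) (e2 e) (e3 e)
  have hεε : ∀ e, ε e = 1 ∨ ε e = -1 := fun e => by
    rw [← mul_self_eq_one_iff]
    have h1 := e1 e
    have h2 := e2 e
    rw [hx1] at h1
    rw [hz1] at h2
    linear_combination h1 + h2 - (1 + ε e * ε e) * hnorm e
  have hα : ∀ e, ∃ α : ℝ, x (e, false) = Real.cos α ∧ z (e, false) = Real.sin α := fun e => by
    have hn : ‖(⟨x (e, false), z (e, false)⟩ : ℂ)‖ = 1 := by
      rw [← sq_eq_sq₀ (norm_nonneg _) zero_le_one, Complex.sq_norm, Complex.normSq_mk, hnorm,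
        one_pow]
    refine ⟨Complex.arg ⟨x (e, false), z (e, false)⟩, ?_, ?_⟩
    · have := Complex.norm_mul_cos_arg ⟨x (e, false), z (e, false)⟩
      rw [hn, one_mul] at this
      exact this.symm
    · have := Complex.norm_mul_sin_arg ⟨x (e, false), z (e, false)⟩
      rw [hn, one_mul] at this
      exact this.symm
  choose α hα1 hα2 using hα
  -- The argument of the map, and the direction in which it turns, at the ends of the edges.
  set ψ : E × Bool → ℝ := fun h =>
    α h.1 + (if h.2 then ε h.1 else -ε h.1) * (θ h.1 / 2) with hψ
  set s : E × Bool → ℝ := fun h => if h.2 then -ε h.1 else ε h.1 with hs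
  have hends : ∀ h, endValue θ x h = Real.cos (ψ h) ∧ endValue θ z h = Real.sin (ψ h) ∧
      endSlope θ x h = -(s h * Real.sin (ψ h)) ∧ endSlope θ z h = s h * Real.cos (ψ h) := by
    rintro ⟨e, b⟩
    rcases hεε e with h | h <;> cases b <;>
      simp only [endValue, endSlope, hψ, hs, hx1, hz1, hα1, hα2, h, smul_eq_mul, if_true,
        Bool.false_eq_true, if_false, neg_neg, neg_mul, one_mul, ← sub_eq_add_neg, Real.cos_add,
        Real.cos_sub, Real.sin_add, Real.sin_sub] <;>
      refine ⟨?_, ?_, ?_, ?_⟩ <;> ring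
  have hψv : ∀ h h', G.vert h = G.vert h' → (ψ h : Real.Angle) = ψ h' := fun h h' hv => by
    refine Real.Angle.cos_sin_inj ?_ ?_
    · rw [← (hends h).1, ← (hends h').1, hx.1 h h' hv]
    · rw [← (hends h).2.1, ← (hends h').2.1, hz.1 h h' hv]
  have hsum : ∀ v, ∑ h : E × Bool with G.vert h = v, s h = 0 := by
    intro v
    have h1 := hx.2 v
    have h2 := hz.2 v
    have hc : ∀ h ∈ Finset.univ.filter fun h : E × Bool => G.vert h = v,
        endSlope θ x h = s h * -Real.sin (ψ (root v)) := fun h hh => by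
      have hv : G.vert h = G.vert (root v) := by rw [hroot]; exact (Finset.mem_filter.1 hh).2
      rw [(hends h).2.2.1, ← (hends h).2.1, ← (hends (root v)).2.1, hz.1 _ _ hv]
      ring
    have hd : ∀ h ∈ Finset.univ.filter fun h : E × Bool => G.vert h = v,
        endSlope θ z h = s h * Real.cos (ψ (root v)) := fun h hh => by
      have hv : G.vert h = G.vert (root v) := by rw [hroot]; exact (Finset.mem_filter.1 hh).2
      rw [(hends h).2.2.2, ← (hends h).1, ← (hends (root v)).1, hx.1 _ _ hv]
    rw [Finset.sum_congr rfl hc, ← Finset.sum_mul] at h1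
    rw [Finset.sum_congr rfl hd, ← Finset.sum_mul] at h2
    have h3 := Real.sin_sq_add_cos_sq (ψ (root v))
    linear_combination (-Real.sin (ψ (root v))) * h1 + Real.cos (ψ (root v)) * h2 -
      (∑ h : E × Bool with G.vert h = v, s h) * h3
  refine ⟨fun e => decide (ε e = 1), fun v => ?_, fun v => ψ (root v), ?_⟩
  · have h1 := hsum v
    rw [Finset.sum_filter, Fintype.sum_prod_type] at h1
    have h2 : ∀ e, ∑ b, (if G.vert (e, b) = v then s (e, b) else 0) =
        (if G.tail (fun e => decide (ε e = 1)) e = v then (1 : ℝ) else 0) -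
          (if G.head (fun e => decide (ε e = 1)) e = v then (1 : ℝ) else 0) := fun e => by
      have hne : (-1 : ℝ) ≠ 1 := by norm_num
      rcases hεε e with h | h
      · simp [tail, head, h, hs, vert]
        split_ifs <;> norm_num
      · simp [tail, head, h, hs, vert, hne]
        split_ifs <;> norm_num
    rw [Finset.sum_congr rfl fun e _ => h2 e, Finset.sum_sub_distrib, ← Finset.sum_filter,
      ← Finset.sum_filter, Finset.sum_const, Finset.sum_const, sub_eq_zero] at h1
    simpa using h1
  · have hn : ∀ e, ∃ n : ℤ, θ e = ψ (root (G.head (fun e => decide (ε e = 1)) e)) -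
        ψ (root (G.tail (fun e => decide (ε e = 1)) e)) + 2 * Real.pi * n := fun e => by
      obtain ⟨m, hm⟩ := Real.Angle.angle_eq_iff_two_pi_dvd_sub.1
        (hψv (root (G.src e)) (e, false) (hroot _))
      obtain ⟨n, hn⟩ := Real.Angle.angle_eq_iff_two_pi_dvd_sub.1
        (hψv (root (G.tgt e)) (e, true) (hroot _))
      simp only [hψ, if_true, Bool.false_eq_true, if_false] at hm hn
      have hne : (-1 : ℝ) ≠ 1 := by norm_num
      rcases hεε e with h | h
      · refine ⟨m - n, ?_⟩
        simp only [tail, head, h, hψ, decide_true, if_true] at hm hn ⊢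
        push_cast
        linarith
      · refine ⟨n - m, ?_⟩
        simp only [tail, head, h, hψ, hne, decide_false, Bool.false_eq_true, if_false] at hm hn ⊢
        push_cast
        linarith
    choose n hn using hn
    exact ⟨n, hn⟩

/-- The vertex functions `φ` matter up to constants only. -/
theorem dimH_circlePoints_le {V E : Type*} [Fintype E] [Fintype V] [Nonempty V]
    (G : OrientedGraph V E) (σ : E → Bool) :
    dimH (G.circlePoints σ) ≤ (Fintype.card V - 1 : ℕ) := by
  let L : (V → ℝ) →ₗ[ℝ] (E → ℝ) :=
    LinearMap.pi fun e => LinearMap.proj (R := ℝ) (φ := fun _ : V => ℝ) (G.head σ e) -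
      LinearMap.proj (R := ℝ) (φ := fun _ : V => ℝ) (G.tail σ e)
  have hL : Module.finrank ℝ (LinearMap.range L) ≤ Fintype.card V - 1 := by
    have h1 := LinearMap.finrank_range_add_finrank_ker L
    have h2 : LinearMap.ker L ≠ ⊥ := by
      rw [Submodule.ne_bot_iff]
      exact ⟨fun _ => 1, by ext e; simp [L], fun h => by
        simpa using congrFun h (Classical.arbitrary V)⟩
    have h3 := Submodule.one_le_finrank_iff.2 h2
    rw [Module.finrank_fintype_fun_eq_card] at h1
    omega
  have hsub : G.circlePoints σ ⊆
      ⋃ n : E → ℤ, (IsometryEquiv.addRight fun e => 2 * Real.pi * n e) '' (LinearMap.range L) := by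
    rintro θ ⟨φ, n, h⟩
    refine mem_iUnion.2 ⟨n, L φ, ⟨φ, rfl⟩, ?_⟩
    funext e
    rw [h]
    rfl
  refine (dimH_mono hsub).trans ?_
  rw [dimH_iUnion]
  refine iSup_le fun n => ?_
  rw [IsometryEquiv.dimH_image]
  have h1 := (isometry_subtype_coe (s := (LinearMap.range L : Set (E → ℝ)))).dimH_image univ
  rw [image_univ, Subtype.range_coe] at h1
  rw [h1]
  exact (Real.dimH_univ_eq_finrank (LinearMap.range L)).trans_le (by exact_mod_cast hL)

end

end OrientedGraph

namespace OrientedGraph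

/-! ### Balanced orientations and cyclic graphs -/

section

variable {V E : Type*} [Fintype E] [DecidableEq V] {G : OrientedGraph V E} {σ : E → Bool}

theorem IsBalanced.tail_surjective (h : G.IsBalanced σ) {root : V → E × Bool}
    (hroot : ∀ v, G.vert (root v) = v) : Function.Surjective (G.tail σ) := by
  intro v
  by_contra! hv
  have h0 : (Finset.univ.filter fun e => G.tail σ e = v).card = 0 := by
    simpa [Finset.filter_eq_empty_iff] using hv
  have h1 : (Finset.univ.filter fun e => G.head σ e = v).card = 0 := by rw [← h v, h0]
  have h2 : ∀ e, G.head σ e ≠ v := by simpa [Finset.filter_eq_empty_iff] using h1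
  have h3 := hroot v
  have h4 := hv (root v).1
  have h5 := h2 (root v).1
  simp only [vert, tail, head] at h3 h4 h5
  split_ifs at h3 h4 h5 <;> contradiction

theorem IsBalanced.head_surjective (h : G.IsBalanced σ) {root : V → E × Bool}
    (hroot : ∀ v, G.vert (root v) = v) : Function.Surjective (G.head σ) := by
  intro v
  obtain ⟨e, he⟩ := h.tail_surjective hroot v
  have h1 : 0 < (Finset.univ.filter fun e => G.head σ e = v).card := by
    rw [← h v, Finset.card_pos]
    exact ⟨e, by simpa using he⟩
  obtain ⟨e', he'⟩ := Finset.card_pos.1 h1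
  exact ⟨e', by simpa using he'⟩

end

section Circle

variable {V E : Type*} {G : OrientedGraph V E} {σ : E → Bool}

/-- If each vertex has exactly one incoming and one outgoing edge, connectedness implies that the
permutation `f`, which maps an edge to the next one, is a cycle on all the edges. -/
theorem Connected.exists_zpow_eq (hG : G.Connected) {T : E ≃ V} {f : Equiv.Perm E}
    (hT : ∀ e, T e = G.tail σ e) (hf : ∀ e, T (f e) = G.head σ e) (e e' : E) :
    ∃ i : ℤ, (f ^ i) e = e' := by
  have hP : ∀ d, (∃ i : ℤ, T ((f ^ i) e) = G.tail σ d) ↔ ∃ i : ℤ, T ((f ^ i) e) = G.head σ d := by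
    intro d
    rw [← hT, ← hf]
    simp only [T.injective.eq_iff]
    constructor
    · rintro ⟨i, hi⟩
      exact ⟨1 + i, by rw [zpow_add, zpow_one, Equiv.Perm.mul_apply, hi]⟩
    · rintro ⟨i, hi⟩
      refine ⟨-1 + i, ?_⟩
      rw [zpow_add, zpow_neg, zpow_one, Equiv.Perm.mul_apply, hi, Equiv.Perm.inv_eq_iff_eq]
  obtain ⟨i, hi⟩ := hG.induction (P := fun v => ∃ i : ℤ, T ((f ^ i) e) = v)
    (fun d => by
      have := hP d
      simp only [tail, head] at this
      split_ifs at this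
      · exact this
      · exact this.symm) ⟨0, rfl⟩ (T e')
  exact ⟨i, T.injective hi⟩

/-- The position of a point on an edge, measured from the initial vertex after a change of
orientation. -/
def position (σ : E → Bool) (p : Σ _ : E, unitInterval) : ℝ :=
  if σ p.1 then p.2 else 1 - p.2

theorem position_mem (σ : E → Bool) (p : Σ _ : E, unitInterval) : position σ p ∈ Icc (0 : ℝ) 1 := by
  have := p.2.2
  unfold position
  split_ifs
  · exact this
  · exact ⟨by linarith [this.2], by linarith [this.1]⟩

theorem exists_position_eq (σ : E → Bool) (e : E) {s : ℝ} (hs : s ∈ Icc (0 : ℝ) 1) :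
    ∃ t, position σ ⟨e, t⟩ = s := by
  by_cases h : σ e
  · exact ⟨⟨s, hs⟩, by simp [position, h]⟩
  · exact ⟨⟨1 - s, ⟨by linarith [hs.2], by linarith [hs.1]⟩⟩, by simp [position, h]⟩

theorem position_injective (σ : E → Bool) {e : E} {t t' : unitInterval}
    (h : position σ ⟨e, t⟩ = position σ ⟨e, t'⟩) : t = t' := by
  unfold position at h
  dsimp only at h
  split_ifs at h
  · exact Subtype.ext h
  · exact Subtype.ext (by linarith)

theorem continuous_position (σ : E → Bool) : Continuous (position σ) := by
  refine continuous_sigma fun e => ?_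
  unfold position
  by_cases h : σ e
  · simp only [h, if_true]; fun_prop
  · simp only [h]; simp only [Bool.false_eq_true, if_false]; fun_prop

theorem position_intervalEnd (σ : E → Bool) (h : E × Bool) :
    position σ (intervalEnd h) = if h.2 = σ h.1 then 1 else 0 := by
  obtain ⟨e, b⟩ := h
  cases b <;> cases h : σ e <;> simp [position, intervalEnd, h]

theorem vert_eq (G : OrientedGraph V E) (σ : E → Bool) (h : E × Bool) :
    G.vert h = if h.2 = σ h.1 then G.head σ h.1 else G.tail σ h.1 := by
  obtain ⟨e, b⟩ := h
  cases b <;> cases h : σ e <;> simp [vert, tail, head, h]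

/-- A connected graph which can be oriented so that each vertex has exactly one incoming and one
outgoing edge is a circle. -/
theorem Connected.nonempty_realization_homeomorph_circle [Fintype E] (hG : G.Connected)
    (ht : Function.Bijective (G.tail σ)) (hh : Function.Bijective (G.head σ)) :
    Nonempty (G.Realization ≃ₜ Circle) := by
  classical
  let T := Equiv.ofBijective _ ht
  let f : Equiv.Perm E := (Equiv.ofBijective _ hh).trans T.symm
  have hT : ∀ e, T e = G.tail σ e := fun e => rfl
  have hf : ∀ e, T (f e) = G.head σ e := fun e => by simp [f]
  obtain ⟨v₀⟩ := hG.nonempty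
  let e₀ := T.symm v₀
  set n := Fintype.card E with hn
  have hn0 : 0 < n := Fintype.card_pos_iff.2 ⟨e₀⟩
  have hcyc : f.IsCycleOn ((Finset.univ : Finset E) : Set E) := by
    refine ⟨by simp [bijOn_univ], fun e _ e' _ => ?_⟩
    exact hG.exists_zpow_eq hT hf e e'
  -- The edges are numbered along the cycle, and the edge with number `j` is mapped to the arc from
  -- `j` to `j + 1` of a circle of length `n`.
  have hj : ∀ e, ∃ j < n, (f ^ j) e₀ = e := fun e =>
    hcyc.exists_pow_eq (Finset.mem_univ _) (Finset.mem_univ _)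
  choose j hjn hj using hj
  have hmod : ∀ a b : ℕ, (f ^ a) e₀ = (f ^ b) e₀ ↔ a ≡ b [MOD n] := fun a b =>
    hcyc.pow_apply_eq_pow_apply (Finset.mem_univ _)
  have hjinj : ∀ e e', j e = j e' → e = e' := fun e e' h => by rw [← hj e, ← hj e', h]
  have : Fact (0 < (n : ℝ)) := ⟨by exact_mod_cast hn0⟩
  have hcast : ∀ a b : ℕ, a ≡ b [MOD n] →
      ((a : ℝ) : AddCircle (n : ℝ)) = ((b : ℝ) : AddCircle (n : ℝ)) := by
    intro a b hab
    obtain ⟨c, hc⟩ := Nat.modEq_iff_dvd.1 hab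
    have h2 : (b : ℝ) - a = c • (n : ℝ) := by
      rw [zsmul_eq_mul, mul_comm]
      exact_mod_cast hc
    rw [eq_comm, ← sub_eq_zero, ← AddCircle.coe_sub, AddCircle.coe_eq_zero_iff]
    exact ⟨c, h2.symm⟩
  let F₀ : (Σ _ : E, unitInterval) → AddCircle (n : ℝ) := fun p =>
    ((j p.1 + position σ p : ℝ) : AddCircle (n : ℝ))
  have hend : ∀ h, F₀ (intervalEnd h) = ((j (T.symm (G.vert h)) : ℝ) : AddCircle (n : ℝ)) := by
    intro h
    simp only [F₀, position_intervalEnd, G.vert_eq σ]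
    change (((j h.1 : ℝ) + _ : ℝ) : AddCircle (n : ℝ)) = _
    split_ifs with hb
    · rw [← hf, Equiv.symm_apply_apply]
      have := hcast (j h.1 + 1) (j (f h.1)) ((hmod _ _).1 (by
        rw [hj, add_comm, pow_add, pow_one, Equiv.Perm.mul_apply, hj]))
      rw [← this]
      push_cast
      rfl
    · rw [← hT, Equiv.symm_apply_apply, add_zero]
  have hglue : ∀ p q, G.Glue p q → F₀ p = F₀ q := by
    rintro _ _ ⟨h, h', hv, rfl, rfl⟩
    rw [hend, hend, hv]
  have hcont₀ : Continuous F₀ := by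
    have h1 : Continuous fun p : (Σ _ : E, unitInterval) => (j p.1 : ℝ) :=
      continuous_sigma fun e => continuous_const (y := (j e : ℝ))
    exact (AddCircle.continuous_mk' (n : ℝ)).comp (h1.add (continuous_position σ))
  let F : G.Realization → AddCircle (n : ℝ) := Quot.lift F₀ hglue
  have hcont : Continuous F := continuous_quot_lift _ hcont₀
  -- Every point has a representative which is not the final point of an edge.
  have hrep : ∀ q : G.Realization, ∃ p, Quot.mk _ p = q ∧ position σ p < 1 := by
    rintro ⟨e, t⟩
    rcases (position_mem σ ⟨e, t⟩).2.lt_or_eq with hlt | heq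
    · exact ⟨_, rfl, hlt⟩
    · refine ⟨intervalEnd (f e, !σ (f e)), Quot.sound ⟨(f e, !σ (f e)), (e, σ e), ?_, rfl, ?_⟩, ?_⟩
      · rw [G.vert_eq σ, G.vert_eq σ, if_neg (by simp), if_pos rfl, ← hT, hf]
      · have h1 : position σ (intervalEnd (e, σ e)) = 1 := by
          rw [position_intervalEnd, if_pos rfl]
        rw [← heq] at h1
        exact Sigma.ext rfl (heq_of_eq (position_injective σ h1).symm)
      · rw [position_intervalEnd, if_neg (by simp)]
        exact zero_lt_one
  have hinj : Function.Injective F := by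
    intro q q' hqq
    obtain ⟨⟨e, t⟩, rfl, hp⟩ := hrep q
    obtain ⟨⟨e', t'⟩, rfl, hp'⟩ := hrep q'
    have hmem : ∀ (e : E) (t : unitInterval), position σ ⟨e, t⟩ < 1 →
        (j e : ℝ) + position σ ⟨e, t⟩ ∈ Ico (0 : ℝ) (0 + n) := by
      intro e t h
      have h1 := (position_mem σ ⟨e, t⟩).1
      have h2 : (j e : ℝ) + 1 ≤ n := by exact_mod_cast hjn e
      exact ⟨by positivity, by linarith⟩
    have heq : (j e : ℝ) + position σ ⟨e, t⟩ = j e' + position σ ⟨e', t'⟩ :=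
      (AddCircle.coe_eq_coe_iff_of_mem_Ico (hmem e t hp) (hmem e' t' hp')).1 hqq
    have h1 := (position_mem σ ⟨e, t⟩).1
    have h2 := (position_mem σ ⟨e', t'⟩).1
    have h3 : j e = j e' := by
      have a1 : (j e : ℝ) < j e' + 1 := by linarith
      have a2 : (j e' : ℝ) < j e + 1 := by linarith
      have a1' : j e < j e' + 1 := by exact_mod_cast a1
      have a2' : j e' < j e + 1 := by exact_mod_cast a2
      omega
    obtain rfl := hjinj e e' h3
    rw [position_injective σ (add_left_cancel heq)]
  have hsurj : Function.Surjective F := by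
    intro y
    obtain ⟨r, hr, rfl⟩ : ∃ r ∈ Ico (0 : ℝ) (0 + n), (r : AddCircle (n : ℝ)) = y :=
      ⟨AddCircle.equivIco (n : ℝ) 0 y, (AddCircle.equivIco (n : ℝ) 0 y).2,
        AddCircle.coe_equivIco⟩
    rw [zero_add] at hr
    have hm : ⌊r⌋₊ < n := (Nat.floor_lt hr.1).2 hr.2
    obtain ⟨t, ht⟩ := exists_position_eq σ ((f ^ ⌊r⌋₊) e₀) (s := r - ⌊r⌋₊)
      ⟨by linarith [Nat.floor_le hr.1], by linarith [Nat.lt_floor_add_one r]⟩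
    refine ⟨Quot.mk _ ⟨(f ^ ⌊r⌋₊) e₀, t⟩, ?_⟩
    have hje : j ((f ^ ⌊r⌋₊) e₀) = ⌊r⌋₊ :=
      ((hmod _ _).1 (hj _)).eq_of_lt_of_lt (hjn _) hm
    change ((j ((f ^ ⌊r⌋₊) e₀) + position σ _ : ℝ) : AddCircle (n : ℝ)) = _
    rw [ht, hje, add_sub_cancel]
  have : CompactSpace G.Realization := inferInstanceAs (CompactSpace (Quot G.Glue))
  let e : G.Realization ≃ₜ AddCircle (n : ℝ) :=
    Continuous.homeoOfEquivCompactToT2 (f := Equiv.ofBijective F ⟨hinj, hsurj⟩) hcont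
  exact ⟨e.trans (AddCircle.homeomorphCircle (Nat.cast_ne_zero.2 hn0.ne'))⟩

end Circle

end OrientedGraph

/-! ### Persistence of the zeros of the determinant -/

section Polynomials

open Polynomial Matrix

variable {ι : Type*} [Fintype ι] [DecidableEq ι]

/-- The polynomial `det (w A + B)` of `w` has a root near `z` if its value at `z` is small, since
this value is the product of the leading coefficient and the differences with the roots. -/
theorem Matrix.exists_root_of_norm_det_lt {A B : Matrix ι ι ℂ} (hA : A.det ≠ 0) {z : ℂ} {δ : ℝ}
    (h : ‖(z • A + B).det‖ < ‖A.det‖ * δ ^ Fintype.card ι) (hδ : 0 ≤ δ) :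
    ∃ w : ℂ, ‖z - w‖ < δ ∧ (w • A + B).det = 0 := by
  set p : ℂ[X] := det ((X : ℂ[X]) • A.map C + B.map C) with hp
  have heval : ∀ w, p.eval w = (w • A + B).det := by
    intro w
    rw [hp, ← coe_evalRingHom, RingHom.map_det]
    congr 1
    ext i j
    simp
    exact mul_comm _ _
  have hdeg : p.natDegree = Fintype.card ι := by
    refine le_antisymm (natDegree_det_X_add_C_le A B) (le_natDegree_of_ne_zero ?_)
    rwa [hp, coeff_det_X_add_C_card]
  have hlead : p.leadingCoeff = A.det := by
    rw [leadingCoeff, hdeg, hp, coeff_det_X_add_C_card]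
  have hsplit := IsAlgClosed.splits p
  have hcard : Multiset.card p.roots = Fintype.card ι := by
    rw [← hsplit.natDegree_eq_card_roots, hdeg]
  have hprod : ∀ m : Multiset ℂ, (∀ w ∈ m, δ ≤ ‖z - w‖) →
      δ ^ Multiset.card m ≤ ‖(m.map fun w => z - w).prod‖ := by
    intro m
    induction m using Multiset.induction_on with
    | empty => simp
    | cons a m ih =>
      intro hm
      rw [Multiset.map_cons, Multiset.prod_cons, norm_mul, Multiset.card_cons, pow_succ']
      exact mul_le_mul (hm a (Multiset.mem_cons_self a m))
        (ih fun w hw => hm w (Multiset.mem_cons_of_mem hw)) (pow_nonneg hδ _) (norm_nonneg _)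
  by_contra! hne
  refine absurd h (not_lt.2 ?_)
  rw [← heval, hsplit.eval_eq_prod_roots, norm_mul, hlead, ← hcard]
  refine mul_le_mul_of_nonneg_left (hprod _ fun w hw => ?_) (norm_nonneg _)
  by_contra! hlt
  exact hne w hlt (by rw [← heval]; exact isRoot_of_mem_roots hw)

end Polynomials

namespace OrientedGraph

open Matrix

variable {V E : Type*} [Fintype E] [DecidableEq E] [DecidableEq V] (G : OrientedGraph V E)
  (root : V → E × Bool)

/-- The matrix `M - i N`, where `M` is the system matrix and `N` its conjugate. -/
noncomputable def phaseMatrix (θ : E → ℝ) : Matrix (E × Bool) (E × Bool) ℂ :=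
  Matrix.of fun h c => (G.systemMatrix root θ h c : ℂ) - G.conjMatrix root θ h c * Complex.I

/-- The matrix `M + i N`, where `M` is the system matrix and `N` its conjugate. -/
noncomputable def conjPhaseMatrix (θ : E → ℝ) : Matrix (E × Bool) (E × Bool) ℂ :=
  Matrix.of fun h c => (G.systemMatrix root θ h c : ℂ) + G.conjMatrix root θ h c * Complex.I

theorem phaseMatrix_mul_conjTranspose (hroot : ∀ v, G.vert (root v) = v) (θ : E → ℝ) :
    G.phaseMatrix root θ * (G.phaseMatrix root θ)ᴴ =
      G.conjPhaseMatrix root θ * (G.conjPhaseMatrix root θ)ᴴ := by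
  ext h g
  have h1 := congrFun (congrFun (G.systemMatrix_mul_conjMatrix_transpose root hroot θ) h) g
  simp only [mul_apply, transpose_apply] at h1
  have h2 : (∑ c, (G.systemMatrix root θ h c : ℂ) * G.conjMatrix root θ g c) =
      ∑ c, (G.conjMatrix root θ h c : ℂ) * G.systemMatrix root θ g c := by exact_mod_cast h1
  simp only [mul_apply, conjTranspose_apply, phaseMatrix, conjPhaseMatrix, Matrix.of_apply,
    RCLike.star_def, map_sub, map_add, map_mul, Complex.conj_ofReal, Complex.conj_I]
  rw [← sub_eq_zero, ← Finset.sum_sub_distrib]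
  have h3 : ∀ c, ((G.systemMatrix root θ h c : ℂ) - G.conjMatrix root θ h c * Complex.I) *
      ((G.systemMatrix root θ g c : ℂ) - G.conjMatrix root θ g c * -Complex.I) -
      ((G.systemMatrix root θ h c : ℂ) + G.conjMatrix root θ h c * Complex.I) *
      ((G.systemMatrix root θ g c : ℂ) + G.conjMatrix root θ g c * -Complex.I) =
      2 * Complex.I * ((G.systemMatrix root θ h c : ℂ) * G.conjMatrix root θ g c -
        (G.conjMatrix root θ h c : ℂ) * G.systemMatrix root θ g c) := fun c => by ring
  rw [Finset.sum_congr rfl fun c _ => h3 c, ← Finset.mul_sum, Finset.sum_sub_distrib, h2, sub_self,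
    mul_zero]

/-- The unitarity of the scattering: `z (M - i N) + w (M + i N)` is singular only if `|z| = |w|`. -/
theorem norm_eq_of_det_phaseMatrix (hroot : ∀ v, G.vert (root v) = v) {θ : E → ℝ} {z w : ℂ}
    (h : (z • G.phaseMatrix root θ + w • G.conjPhaseMatrix root θ).det = 0) : ‖z‖ = ‖w‖ := by
  obtain ⟨y, hy, hy0⟩ := exists_vecMul_eq_zero_iff.2 h
  set A := G.phaseMatrix root θ with hA
  set B := G.conjPhaseMatrix root θ with hB
  have key : ∀ C : Matrix (E × Bool) (E × Bool) ℂ,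
      ((∑ c, ‖(y ᵥ* C) c‖ ^ 2 : ℝ) : ℂ) = (y ᵥ* (C * Cᴴ)) ⬝ᵥ star y := by
    intro C
    rw [← vecMul_vecMul, ← dotProduct_mulVec, ← star_vecMul, dotProduct]
    push_cast
    refine Finset.sum_congr rfl fun c _ => ?_
    rw [Pi.star_apply, RCLike.star_def, Complex.mul_conj, Complex.normSq_eq_norm_sq]
    push_cast
    rfl
  have hAB : (∑ c, ‖(y ᵥ* A) c‖ ^ 2) = ∑ c, ‖(y ᵥ* B) c‖ ^ 2 := by
    have : ((∑ c, ‖(y ᵥ* A) c‖ ^ 2 : ℝ) : ℂ) = ((∑ c, ‖(y ᵥ* B) c‖ ^ 2 : ℝ) : ℂ) := by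
      rw [key, key, G.phaseMatrix_mul_conjTranspose root hroot]
    exact_mod_cast this
  have hzw : ‖z‖ ^ 2 * (∑ c, ‖(y ᵥ* A) c‖ ^ 2) = ‖w‖ ^ 2 * ∑ c, ‖(y ᵥ* B) c‖ ^ 2 := by
    rw [Finset.mul_sum, Finset.mul_sum]
    refine Finset.sum_congr rfl fun c _ => ?_
    rw [← mul_pow, ← mul_pow, ← norm_mul, ← norm_mul]
    have := congrFun hy0 c
    rw [vecMul_add, vecMul_smul, vecMul_smul] at this
    simp only [Pi.add_apply, Pi.smul_apply, smul_eq_mul, Pi.zero_apply] at this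
    rw [eq_neg_of_add_eq_zero_left this, norm_neg]
  have hq : (∑ c, ‖(y ᵥ* A) c‖ ^ 2) ≠ 0 := by
    intro h0
    have hA0 : ∀ c, (y ᵥ* A) c = 0 := fun c => by
      have := (Finset.sum_eq_zero_iff_of_nonneg fun c _ => sq_nonneg _).1 h0 c (Finset.mem_univ c)
      simpa using this
    have hB0 : ∀ c, (y ᵥ* B) c = 0 := fun c => by
      have := (Finset.sum_eq_zero_iff_of_nonneg fun c _ => sq_nonneg _).1 (hAB ▸ h0) c
        (Finset.mem_univ c)
      simpa using this
    have e1 : ∀ c, ∑ h, y h * (G.systemMatrix root θ h c : ℂ) = 0 := fun c => by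
      have h1 := hA0 c
      have h2 := hB0 c
      simp only [vecMul, dotProduct, hA, hB, phaseMatrix, conjPhaseMatrix, Matrix.of_apply] at h1 h2
      have h3 : ∑ h, y h * (G.systemMatrix root θ h c : ℂ) +
          ∑ h, y h * (G.systemMatrix root θ h c : ℂ) = 0 := by
        rw [← add_zero (0 : ℂ)]
        nth_rewrite 1 [← h1]
        rw [← h2, ← Finset.sum_add_distrib, ← Finset.sum_add_distrib]
        exact Finset.sum_congr rfl fun h _ => by ring
      exact self_eq_neg.1 (eq_neg_of_add_eq_zero_left h3)
    have e2 : ∀ c, ∑ h, y h * (G.conjMatrix root θ h c : ℂ) = 0 := fun c => by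
      have h1 := hA0 c
      simp only [vecMul, dotProduct, hA, phaseMatrix, Matrix.of_apply, mul_sub,
        Finset.sum_sub_distrib, e1, zero_sub, neg_eq_zero, ← mul_assoc, ← Finset.sum_mul] at h1
      exact (mul_eq_zero.1 h1).resolve_right Complex.I_ne_zero
    apply hy
    have hre : (fun h => (y h).re) = 0 := by
      refine G.eq_zero_of_vecMul_systemMatrix_conjMatrix root hroot (θ := θ) ?_ ?_
      · funext c
        simpa [vecMul, dotProduct] using congrArg Complex.re (e1 c)
      · funext c
        simpa [vecMul, dotProduct] using congrArg Complex.re (e2 c)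
    have him : (fun h => (y h).im) = 0 := by
      refine G.eq_zero_of_vecMul_systemMatrix_conjMatrix root hroot (θ := θ) ?_ ?_
      · funext c
        simpa [vecMul, dotProduct] using congrArg Complex.im (e1 c)
      · funext c
        simpa [vecMul, dotProduct] using congrArg Complex.im (e2 c)
    funext h
    exact Complex.ext (congrFun hre h) (congrFun him h)
  rw [← hAB] at hzw
  have := mul_right_cancel₀ hq hzw
  exact (sq_eq_sq₀ (norm_nonneg _) (norm_nonneg _)).1 this

/-- The combinations of the phase matrices with coefficients of modulus one are, up to a scalar, the
system matrices on a line of direction `(1, …, 1)`. -/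
theorem smul_phaseMatrix_add (θ : E → ℝ) (s : ℝ) :
    Complex.exp (s * Complex.I) • G.phaseMatrix root θ + G.conjPhaseMatrix root θ =
      (2 * Complex.exp ((s / 2 : ℝ) * Complex.I)) •
        (G.systemMatrix root (θ + fun _ => s)).map (algebraMap ℝ ℂ) := by
  ext h c
  simp only [Matrix.add_apply, Matrix.smul_apply, Matrix.map_apply, systemMatrix_add, phaseMatrix,
    conjPhaseMatrix, Matrix.of_apply, smul_eq_mul, Complex.coe_algebraMap]
  push_cast
  have h1 : Complex.exp (s * Complex.I) = Complex.exp (s / 2 * Complex.I) ^ 2 := by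
    rw [← Complex.exp_nat_mul]
    congr 1
    push_cast
    ring
  rw [h1, Complex.exp_mul_I]
  have h2 := Complex.sin_sq_add_cos_sq ((s : ℂ) / 2)
  have h3 := Complex.I_sq
  set C := Complex.cos ((s : ℂ) / 2)
  set S := Complex.sin ((s : ℂ) / 2)
  set m := (G.systemMatrix root θ h c : ℂ)
  set n := (G.conjMatrix root θ h c : ℂ)
  linear_combination (m * S ^ 2 - n * S ^ 2 * Complex.I - 2 * n * C * S) * h3 +
    (-m - n * Complex.I) * h2

theorem continuous_systemMatrix (h c : E × Bool) :
    Continuous fun θ => G.systemMatrix root θ h c :=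
  continuous_iff_continuousAt.2 fun θ =>
    (G.hasStrictFDerivAt_systemMatrix root θ h c).continuousAt

theorem continuous_conjMatrix (h c : E × Bool) : Continuous fun θ => G.conjMatrix root θ h c := by
  have : (fun θ => G.conjMatrix root θ h c) = fun θ : E → ℝ =>
      G.conjMatrix root 0 h c * Real.cos (θ c.1 / 2) -
        G.systemMatrix root 0 h c * Real.sin (θ c.1 / 2) := by
    funext θ
    rw [← conjMatrix_add, zero_add]
  rw [this]
  fun_prop

/-- The zeros of the determinant persist on the lines of direction `(1, …, 1)`. The determinant is,
on such a line, a polynomial in `exp (i s)` with all its roots on the unit circle, which depends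
continuously on the line. -/
theorem eventually_exists_det_eq_zero (hroot : ∀ v, G.vert (root v) = v) {θ₀ : E → ℝ}
    (h₀ : (G.systemMatrix root θ₀).det = 0) {ε : ℝ} (hε : 0 < ε) :
    ∀ᶠ θ in 𝓝 θ₀, ∃ s : ℝ, |s| < ε ∧ (G.systemMatrix root (θ + fun _ => s)).det = 0 := by
  obtain ⟨δ, hδ, hδε⟩ : ∃ δ > 0, ∀ w : ℂ, ‖1 - w‖ < δ → |Complex.arg w| < ε := by
    have hc := (Complex.continuousAt_arg (x := 1) (by simp [Complex.slitPlane])).abs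
    simp only [ContinuousAt, Complex.arg_one, abs_zero] at hc
    obtain ⟨δ, hδ, h⟩ := Metric.eventually_nhds_iff.1 (hc.eventually_lt_const hε)
    refine ⟨δ, hδ, fun w hw => h ?_⟩
    rw [dist_eq_norm, norm_sub_rev]
    exact hw
  have hA : ∀ θ, (G.phaseMatrix root θ).det ≠ 0 := fun θ h => by
    have := G.norm_eq_of_det_phaseMatrix root hroot (θ := θ) (z := 1) (w := 0) (by simpa using h)
    simp at this
  have hcA : Continuous fun θ => (G.phaseMatrix root θ) := by
    refine continuous_matrix fun h c => ?_
    have h1 := G.continuous_systemMatrix root h c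
    have h2 := G.continuous_conjMatrix root h c
    simp only [phaseMatrix, Matrix.of_apply]
    fun_prop
  have hcB : Continuous fun θ => (G.conjPhaseMatrix root θ) := by
    refine continuous_matrix fun h c => ?_
    have h1 := G.continuous_systemMatrix root h c
    have h2 := G.continuous_conjMatrix root h c
    simp only [conjPhaseMatrix, Matrix.of_apply]
    fun_prop
  have hlt : ∀ᶠ θ in 𝓝 θ₀, ‖((1 : ℂ) • G.phaseMatrix root θ + G.conjPhaseMatrix root θ).det‖ <
      ‖(G.phaseMatrix root θ).det‖ * δ ^ Fintype.card (E × Bool) := by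
    refine ContinuousAt.eventually_lt (by fun_prop) (by fun_prop) ?_
    have h1 := G.smul_phaseMatrix_add root θ₀ 0
    have h2 : (θ₀ + fun _ => (0 : ℝ)) = θ₀ := by funext e; simp
    rw [h2] at h1
    simp only [Complex.ofReal_zero, zero_mul, Complex.exp_zero] at h1
    rw [h1, det_smul, ← RingHom.mapMatrix_apply, ← RingHom.map_det, h₀, map_zero, mul_zero,
      norm_zero]
    exact mul_pos (norm_pos_iff.2 (hA θ₀)) (pow_pos hδ _)
  filter_upwards [hlt] with θ hθ
  obtain ⟨w, hw, hw0⟩ := Matrix.exists_root_of_norm_det_lt (hA θ) hθ hδ.le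
  have hw1 : ‖w‖ = 1 := by
    have := G.norm_eq_of_det_phaseMatrix root hroot (θ := θ) (z := w) (w := 1) (by simpa using hw0)
    simpa using this
  refine ⟨Complex.arg w, hδε w hw, ?_⟩
  have hwe : Complex.exp (Complex.arg w * Complex.I) = w := by
    have := Complex.norm_mul_exp_arg_mul_I w
    rwa [hw1, Complex.ofReal_one, one_mul] at this
  have h1 := G.smul_phaseMatrix_add root θ (Complex.arg w)
  rw [hwe] at h1
  rw [h1, det_smul, mul_eq_zero] at hw0
  rcases hw0 with h | h
  · exact absurd h (pow_ne_zero _ (mul_ne_zero two_ne_zero (Complex.exp_ne_zero _)))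
  · rw [← RingHom.mapMatrix_apply, ← RingHom.map_det] at h
    simpa using h

/-! ### The dimension of the determinant manifold -/

theorem norm_coe_angle_le (x : ℝ) : ‖(x : Real.Angle)‖ ≤ |x| :=
  QuotientAddGroup.norm_mk_le_norm

theorem norm_coe_angle_eq {x : ℝ} (hx : |x| ≤ Real.pi) : ‖(x : Real.Angle)‖ = |x| := by
  refine (AddCircle.norm_coe_eq_abs_iff (2 * Real.pi) Real.two_pi_pos.ne').2 ?_
  rw [abs_of_pos Real.two_pi_pos]
  linarith

theorem lipschitzWith_torusPoint {E : Type*} [Fintype E] : LipschitzWith 1 (torusPoint : (E → ℝ) → E → Real.Angle) := by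
  refine LipschitzWith.of_dist_le_mul fun x y => ?_
  rw [NNReal.coe_one, one_mul, dist_pi_le_iff dist_nonneg]
  intro e
  rw [dist_eq_norm]
  have h1 : torusPoint x e - torusPoint y e = ((x e - y e : ℝ) : Real.Angle) := by
    simp [torusPoint]
  rw [h1]
  exact (norm_coe_angle_le _).trans (dist_le_pi_dist x y e)

theorem dist_torusPoint {E : Type*} [Fintype E] {x y : E → ℝ} (h : ∀ e, |x e - y e| ≤ Real.pi) :
    dist (torusPoint x) (torusPoint y) = dist x y := by
  have h1 : ∀ e, dist (torusPoint x e) (torusPoint y e) = dist (x e) (y e) := by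
    intro e
    rw [dist_eq_norm]
    have h1 : torusPoint x e - torusPoint y e = ((x e - y e : ℝ) : Real.Angle) := by
      simp [torusPoint]
    rw [h1, norm_coe_angle_eq (h e)]
    rfl
  refine le_antisymm ?_ ?_
  · rw [dist_pi_le_iff dist_nonneg]
    exact fun e => (h1 e).trans_le (dist_le_pi_dist x y e)
  · rw [dist_pi_le_iff dist_nonneg]
    exact fun e => (h1 e).symm.trans_le (dist_le_pi_dist _ _ e)

theorem exists_torusPoint_eq {E : Type*} (p : E → Real.Angle) : ∃ θ : E → ℝ, torusPoint θ = p :=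
  ⟨fun e => (p e).toReal, by funext e; simp [torusPoint]⟩

/-- The determinant manifold has codimension at most one at each of its points: it projects onto
an open set along the direction `(1, …, 1)`. -/
theorem le_dimH_detManifold (hroot : ∀ v, G.vert (root v) = v) (e₀ : E) {z : E → Real.Angle}
    (hz : z ∈ G.detManifold root) {U : Set (E → Real.Angle)} (hU : U ∈ 𝓝 z) :
    ((Fintype.card E - 1 : ℕ) : ℝ≥0∞) ≤ dimH (G.detManifold root ∩ U) := by
  obtain ⟨θ₀, rfl⟩ := exists_torusPoint_eq z
  have hdet : ∀ θ, torusPoint θ ∈ G.detManifold root ↔ (G.systemMatrix root θ).det = 0 := by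
    intro θ
    rw [← delta_torusPoint]
    rfl
  obtain ⟨r, hr, hrU⟩ : ∃ r, 0 < r ∧ Metric.ball θ₀ r ⊆ torusPoint ⁻¹' U :=
    Metric.mem_nhds_iff.1 (lipschitzWith_torusPoint.continuous.continuousAt hU)
  -- The radius is at most one, so that the projection to the torus is isometric on `A`.
  set A : Set (E → ℝ) := {θ | (∀ e, |θ e - θ₀ e| < min r 1) ∧ (G.systemMatrix root θ).det = 0}
    with hA
  have hr1 : 0 < min r 1 := lt_min hr one_pos
  have hsub : torusPoint '' A ⊆ G.detManifold root ∩ U := by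
    rintro _ ⟨θ, hθ, rfl⟩
    refine ⟨(hdet θ).2 hθ.2, hrU ?_⟩
    rw [Metric.mem_ball, dist_pi_lt_iff hr]
    exact fun e => (hθ.1 e).trans_le (min_le_left _ _)
  have hisom : Isometry (fun θ : A => torusPoint θ.1) := by
    refine Isometry.of_dist_eq fun x y => dist_torusPoint fun e => ?_
    have h1 := (x.2.1 e).trans_le (min_le_right _ _)
    have h2 := (y.2.1 e).trans_le (min_le_right _ _)
    have h3 := Real.two_le_pi
    rw [abs_lt] at h1 h2
    rw [abs_le]
    constructor <;> linarith
  have hdim : dimH (torusPoint '' A) = dimH A := by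
    have h1 := hisom.dimH_image univ
    have h2 := (isometry_subtype_coe (s := A)).dimH_image univ
    rw [image_univ] at h1 h2
    rw [Subtype.range_coe] at h2
    rw [h2, ← h1]
    congr 1
    exact image_eq_range _ _
  refine le_trans ?_ (dimH_mono hsub)
  rw [hdim]
  let L : (E → ℝ) →L[ℝ] ({e // e ≠ e₀} → ℝ) :=
    ContinuousLinearMap.pi fun e => ContinuousLinearMap.proj (R := ℝ) (φ := fun _ : E => ℝ) e.1 -
      ContinuousLinearMap.proj (R := ℝ) (φ := fun _ : E => ℝ) e₀
  refine le_trans ?_ (L.lipschitz.dimH_image_le A)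
  have hnhds : L '' A ∈ 𝓝 (L θ₀) := by
    -- The section of `L` whose image consists of the points with the same coordinate `e₀` as `θ₀`.
    let ζ : ({e // e ≠ e₀} → ℝ) → E → ℝ := fun τ e =>
      if h : e = e₀ then θ₀ e₀ else τ ⟨e, h⟩ + θ₀ e₀
    have hζc : Continuous ζ := by
      refine continuous_pi fun e => ?_
      by_cases h : e = e₀
      · simp only [ζ, h, dite_true]; fun_prop
      · simp only [ζ, h, dite_false]; fun_prop
    have hζ₀ : ζ (L θ₀) = θ₀ := by
      funext e
      by_cases h : e = e₀
      · simp [ζ, h]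
      · simp [ζ, h, L]
    have hLζ : ∀ τ s, L (ζ τ + fun _ => s) = τ := by
      intro τ s
      funext e
      simp [L, ζ, e.2]
    have hz0 : (G.systemMatrix root θ₀).det = 0 := (hdet θ₀).1 hz
    have h1 := G.eventually_exists_det_eq_zero root hroot hz0 (ε := min r 1 / 2) (by positivity)
    have h2 : ∀ᶠ θ in 𝓝 θ₀, dist θ θ₀ < min r 1 / 2 :=
      Metric.ball_mem_nhds θ₀ (by positivity)
    have h3 : Tendsto ζ (𝓝 (L θ₀)) (𝓝 θ₀) := by
      have := hζc.tendsto (L θ₀)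
      rwa [hζ₀] at this
    filter_upwards [h3.eventually h1, h3.eventually h2] with τ hτ hτ2
    obtain ⟨s, hs, hs0⟩ := hτ
    refine ⟨ζ τ + fun _ => s, ⟨fun e => ?_, hs0⟩, hLζ τ s⟩
    have h4 : |ζ τ e - θ₀ e| < min r 1 / 2 := (dist_le_pi_dist (ζ τ) θ₀ e).trans_lt hτ2
    calc |ζ τ e + s - θ₀ e| = |(ζ τ e - θ₀ e) + s| := by
          congr 1; ring
      _ ≤ |ζ τ e - θ₀ e| + |s| := abs_add_le _ _
      _ < min r 1 := by linarith
  rw [Real.dimH_of_mem_nhds hnhds, Module.finrank_fintype_fun_eq_card]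
  simp

end OrientedGraph

/-! ### The eigenvalue equation on an edge -/

theorem IsACWithDeriv.continuousOn {l : ℝ} {F F' : ℝ → ℂ} (h : IsACWithDeriv l F F') (hl : 0 ≤ l) :
    ContinuousOn F (Icc (-l / 2) (l / 2)) := by
  have hl' : -l / 2 ≤ l / 2 := by linarith
  have h1 : ContinuousOn (fun t => F (-l / 2) + ∫ s in (-l / 2)..t, F' s)
      (Icc (-l / 2) (l / 2)) := by
    refine continuousOn_const.add ?_
    have := intervalIntegral.continuousOn_primitive_interval'
      (h.intervalIntegrable (right_mem_Icc.2 hl')) (left_mem_uIcc (a := -l / 2) (b := l / 2))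
    rwa [uIcc_of_le hl'] at this
  exact h1.congr h.2

theorem IsACWithDeriv.hasDerivWithinAt {l : ℝ} {F F' : ℝ → ℂ} (h : IsACWithDeriv l F F')
    (hF' : ContinuousOn F' (Icc (-l / 2) (l / 2))) {t : ℝ} (ht : t ∈ Icc (-l / 2) (l / 2)) :
    HasDerivWithinAt F (F' t) (Icc (-l / 2) (l / 2)) t := by
  have : Fact (t ∈ Icc (-l / 2) (l / 2)) := ⟨ht⟩
  have h1 := intervalIntegral.integral_hasDerivWithinAt_right (s := Icc (-l / 2) (l / 2))
    (t := Icc (-l / 2) (l / 2)) (h.intervalIntegrable ht)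
    (hF'.stronglyMeasurableAtFilter_nhdsWithin measurableSet_Icc t) (hF' t ht)
  exact (h1.const_add (F (-l / 2))).congr h.2 (h.2 t ht)

theorem isACWithDeriv_of_hasDerivAt {l : ℝ} {F F' : ℝ → ℂ}
    (hF : ∀ t, HasDerivAt F (F' t) t) (hF' : Continuous F') : IsACWithDeriv l F F' := by
  refine ⟨hF'.continuousOn.integrableOn_Icc, fun t ht => ?_⟩
  rw [intervalIntegral.integral_eq_sub_of_hasDerivAt (fun s _ => hF s)
    (hF'.intervalIntegrable _ _)]
  ring

/-- The function `a cos kt + b sin kt`. -/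
noncomputable def wave (k : ℝ) (a b : ℂ) (t : ℝ) : ℂ :=
  a * (Real.cos (k * t) : ℂ) + b * (Real.sin (k * t) : ℂ)

theorem hasDerivAt_wave (k : ℝ) (a b : ℂ) (t : ℝ) :
    HasDerivAt (wave k a b) (wave k (k * b) (-(k * a)) t) t := by
  have hk : HasDerivAt (fun t : ℝ => k * t) k t := by simpa using (hasDerivAt_id t).const_mul k
  have h1 := (hk.cos.ofReal_comp.const_mul a).add (hk.sin.ofReal_comp.const_mul b)
  refine h1.congr_deriv ?_
  simp only [wave]
  push_cast
  ring

theorem continuous_wave (k : ℝ) (a b : ℂ) : Continuous (wave k a b) :=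
  continuous_iff_continuousAt.2 fun t => (hasDerivAt_wave k a b t).continuousAt

theorem isACWithDeriv_wave (l k : ℝ) (a b : ℂ) :
    IsACWithDeriv l (wave k a b) (wave k (k * b) (-(k * a))) :=
  isACWithDeriv_of_hasDerivAt (hasDerivAt_wave k a b) (continuous_wave _ _ _)

/-- The solutions of `F'' = - k² F`, in the sense of absolutely continuous functions. -/
theorem exists_eq_wave {l k : ℝ} (hl : 0 < l) (hk : 0 < k) {F F' : ℝ → ℂ}
    (h1 : IsACWithDeriv l F F') (h2 : IsACWithDeriv l F' fun t => -((k : ℂ) ^ 2 * F t)) :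
    ∃ a b : ℂ, ∀ t ∈ Icc (-l / 2) (l / 2),
      F t = wave k a b t ∧ F' t = wave k (k * b) (-(k * a)) t := by
  have hk' : (k : ℂ) ≠ 0 := by exact_mod_cast hk.ne'
  have hl' : -l / 2 < l / 2 := by linarith
  have hF := h1.continuousOn hl.le
  have hF' := h2.continuousOn hl.le
  have d1 := fun t ht => h1.hasDerivWithinAt hF' (t := t) ht
  have d2 := fun t ht => h2.hasDerivWithinAt (by fun_prop) (t := t) ht
  have hkt : ∀ t, HasDerivAt (fun t : ℝ => k * t) k t := fun t => by
    simpa using (hasDerivAt_id t).const_mul k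
  have dc : ∀ t s, HasDerivWithinAt (fun t : ℝ => (Real.cos (k * t) : ℂ)) _ s t := fun t s =>
    ((hkt t).cos.ofReal_comp).hasDerivWithinAt
  have ds : ∀ t s, HasDerivWithinAt (fun t : ℝ => (Real.sin (k * t) : ℂ)) _ s t := fun t s =>
    ((hkt t).sin.ofReal_comp).hasDerivWithinAt
  have hconst : ∀ (g g' : ℝ → ℂ), (∀ t ∈ Icc (-l / 2) (l / 2),
      HasDerivWithinAt g (g' t) (Icc (-l / 2) (l / 2)) t) → (∀ t, g' t = 0) →
      ∀ t ∈ Icc (-l / 2) (l / 2), g t = g (-l / 2) := by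
    intro g g' hg hg0
    refine constant_of_derivWithin_zero (fun t ht => (hg t ht).differentiableWithinAt)
      fun t ht => ?_
    rw [(hg t (Ico_subset_Icc_self ht)).derivWithin (uniqueDiffOn_Icc hl' t
      (Ico_subset_Icc_self ht)), hg0]
  have hg := hconst _ _ (fun t ht => ((d1 t ht).mul (dc t _)).sub
    (((d2 t ht).mul (ds t _)).div_const (k : ℂ))) (fun t => by
      push_cast
      field_simp
      ring)
  have hh := hconst _ _ (fun t ht => ((d1 t ht).mul (ds t _)).add
    (((d2 t ht).mul (dc t _)).div_const (k : ℂ))) (fun t => by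
      push_cast
      field_simp
      ring)
  -- The two first integrals of the equation are the coefficients.
  obtain ⟨a, ha⟩ : ∃ a : ℂ, ∀ t ∈ Icc (-l / 2) (l / 2),
      F t * (Real.cos (k * t) : ℂ) - F' t * (Real.sin (k * t) : ℂ) / k = a := ⟨_, hg⟩
  obtain ⟨b, hb⟩ : ∃ b : ℂ, ∀ t ∈ Icc (-l / 2) (l / 2),
      F t * (Real.sin (k * t) : ℂ) + F' t * (Real.cos (k * t) : ℂ) / k = b := ⟨_, hh⟩
  refine ⟨a, b, fun t ht => ?_⟩
  have hsc : (Real.sin (k * t) : ℂ) ^ 2 + (Real.cos (k * t) : ℂ) ^ 2 = 1 := by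
    exact_mod_cast Real.sin_sq_add_cos_sq (k * t)
  rw [← ha t ht, ← hb t ht]
  simp only [wave]
  constructor
  · linear_combination (-F t) * hsc
  · field_simp
    linear_combination (-F' t) * hsc

theorem wave_coeff_eq_zero {l k : ℝ} (hl : 0 < l) (hk : 0 < k) {a b : ℂ}
    (h : wave k a b =ᵐ[OrientedGraph.edgeMeasure l] 0) : a = 0 ∧ b = 0 := by
  have hl' : -l / 2 < l / 2 := by linarith
  have h0 : EqOn (wave k a b) 0 (Icc (-l / 2) (l / 2)) :=
    Measure.eqOn_Icc_of_ae_eq volume hl'.ne h (continuous_wave k a b).continuousOn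
      continuousOn_const
  have ha : a = 0 := by
    have := h0 (x := 0) ⟨by linarith, by linarith⟩
    simpa [wave] using this
  refine ⟨ha, ?_⟩
  -- A point of the edge where the sine does not vanish.
  have hm : 0 < min (l / 2) (Real.pi / (2 * k)) := by
    have := Real.pi_pos
    positivity
  have := h0 (x := min (l / 2) (Real.pi / (2 * k))) ⟨by linarith, min_le_left _ _⟩
  simp only [wave, ha, zero_mul, zero_add, Pi.zero_apply, mul_eq_zero, Complex.ofReal_eq_zero]
    at this
  refine this.resolve_right (Real.sin_pos_of_pos_of_lt_pi (by positivity) ?_).ne'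
  calc k * min (l / 2) (Real.pi / (2 * k)) ≤ k * (Real.pi / (2 * k)) := by
        gcongr
        exact min_le_right _ _
    _ = Real.pi / 2 := by field_simp
    _ < Real.pi := half_lt_self Real.pi_pos

theorem LinearPMap.mem_eigenspace_iff {H : Type*} [AddCommGroup H] [Module ℂ H] {A : H →ₗ.[ℂ] H}
    {μ : ℂ} {φ : H} : φ ∈ A.eigenspace μ ↔ (φ, μ • φ) ∈ A.graph := by
  rw [LinearPMap.mem_graph_iff]
  constructor
  · rintro ⟨y, hy, rfl⟩
    exact ⟨y, rfl, sub_eq_zero.1 hy⟩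
  · rintro ⟨y, rfl, hy⟩
    exact ⟨y, sub_eq_zero.2 hy, rfl⟩

namespace OrientedGraph

/-! ### The eigenfunctions of the Laplacian -/

section Eigen

theorem endParam_mem {E : Type*} {ℓ : E → ℝ} (hℓ : ∀ e, 0 < ℓ e) (h : E × Bool) :
    endParam ℓ h ∈ Icc (-ℓ h.1 / 2) (ℓ h.1 / 2) := by
  have := hℓ h.1
  unfold endParam
  split_ifs
  · exact ⟨by linarith, le_rfl⟩
  · exact ⟨le_rfl, by linarith⟩

variable {V E : Type*} [Fintype E]

theorem memLp_wave (k l : ℝ) (a b : ℂ) : MemLp (wave k a b) 2 (edgeMeasure l) := by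
  have : IsFiniteMeasure (edgeMeasure l) := by unfold edgeMeasure; infer_instance
  refine MemLp.of_bound (continuous_wave k a b).aestronglyMeasurable (‖a‖ + ‖b‖)
    (Eventually.of_forall fun t => ?_)
  refine (norm_add_le _ _).trans (add_le_add ?_ ?_)
  · rw [norm_mul, Complex.norm_real, Real.norm_eq_abs]
    exact mul_le_of_le_one_right (norm_nonneg _) (Real.abs_cos_le_one _)
  · rw [norm_mul, Complex.norm_real, Real.norm_eq_abs]
    exact mul_le_of_le_one_right (norm_nonneg _) (Real.abs_sin_le_one _)

/-- The square integrable function with given coefficients on the edges. -/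
noncomputable def waveL2 (ℓ : E → ℝ) (k : ℝ) : (E × Bool → ℂ) →ₗ[ℂ] L2 ℓ where
  toFun x := WithLp.toLp 2 fun e => (memLp_wave k (ℓ e) (x (e, false)) (x (e, true))).toLp _
  map_add' x y := by
    ext1 e
    simp only [PiLp.add_apply]
    rw [← MemLp.toLp_add]
    refine MemLp.toLp_congr _ _ (Eventually.of_forall fun t => ?_)
    simp only [wave, Pi.add_apply]
    ring
  map_smul' c x := by
    ext1 e
    simp only [PiLp.smul_apply, RingHom.id_apply]
    rw [← MemLp.toLp_const_smul]
    refine MemLp.toLp_congr _ _ (Eventually.of_forall fun t => ?_)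
    simp only [wave, Pi.smul_apply, smul_eq_mul]
    ring

theorem waveL2_apply_ae (ℓ : E → ℝ) (k : ℝ) (x : E × Bool → ℂ) (e : E) :
    waveL2 ℓ k x e =ᵐ[edgeMeasure (ℓ e)] wave k (x (e, false)) (x (e, true)) :=
  MemLp.coeFn_toLp (memLp_wave k (ℓ e) (x (e, false)) (x (e, true)))

theorem eq_waveL2_iff {ℓ : E → ℝ} {k : ℝ} {φ : L2 ℓ} {x : E × Bool → ℂ} :
    φ = waveL2 ℓ k x ↔ HasEdgeForm φ k (fun e => x (e, false)) (fun e => x (e, true)) := by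
  constructor
  · rintro rfl
    exact waveL2_apply_ae ℓ k x
  · intro h
    ext1 e
    exact Lp.ext ((h e).trans (waveL2_apply_ae ℓ k x e).symm)

theorem waveL2_injective {ℓ : E → ℝ} (hℓ : ∀ e, 0 < ℓ e) {k : ℝ} (hk : 0 < k) :
    Function.Injective (waveL2 ℓ k) := by
  rw [← LinearMap.ker_eq_bot, LinearMap.ker_eq_bot']
  intro x hx
  have h : ∀ e, x (e, false) = 0 ∧ x (e, true) = 0 := fun e => by
    refine wave_coeff_eq_zero (hℓ e) hk ((waveL2_apply_ae ℓ k x e).symm.trans ?_)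
    rw [hx]
    exact Lp.coeFn_zero _ _ _
  funext ⟨e, b⟩
  cases b
  · exact (h e).1
  · exact (h e).2

variable [DecidableEq V] (G : OrientedGraph V E)

/-- Only the values of `f` and `f'` at the ends of the edges enter the vertex conditions. -/
theorem vertexConditions_wave_iff {ℓ : E → ℝ} {k : ℝ} (hk : 0 < k) {x : E × Bool → ℂ}
    {f f' : E → ℝ → ℂ}
    (hf : ∀ h : E × Bool, f h.1 (endParam ℓ h) =
      wave k (x (h.1, false)) (x (h.1, true)) (endParam ℓ h))
    (hf' : ∀ h : E × Bool, f' h.1 (endParam ℓ h) =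
      wave k (k * x (h.1, true)) (-(k * x (h.1, false))) (endParam ℓ h)) :
    G.VertexConditions ℓ f f' ↔
      (∀ h h', G.vert h = G.vert h' → endValue (k • ℓ) x h = endValue (k • ℓ) x h') ∧
      ∀ v, ∑ h : E × Bool with G.vert h = v, endSlope (k • ℓ) x h = 0 := by
  have hk' : (k : ℂ) ≠ 0 := by exact_mod_cast hk.ne'
  have e1 : ∀ h : E × Bool, f h.1 (endParam ℓ h) = endValue (k • ℓ) x h := by
    intro h
    rw [hf]
    obtain ⟨e, b⟩ := h
    have h1 : k * (-ℓ e / 2) = -(k * ℓ e / 2) := by ring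
    have h2 : k * (ℓ e / 2) = k * ℓ e / 2 := by ring
    cases b <;> simp [wave, endParam, endValue, h1, h2] <;> ring
  have e2 : ∀ h : E × Bool, (if h.2 then -f' h.1 (endParam ℓ h) else f' h.1 (endParam ℓ h)) =
      k * endSlope (k • ℓ) x h := by
    intro h
    rw [hf']
    obtain ⟨e, b⟩ := h
    have h1 : k * (-ℓ e / 2) = -(k * ℓ e / 2) := by ring
    have h2 : k * (ℓ e / 2) = k * ℓ e / 2 := by ring
    cases b <;> simp [wave, endParam, endSlope, h1, h2] <;> ring
  constructor
  · rintro ⟨c1, c2⟩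
    refine ⟨fun h h' hv => by rw [← e1, ← e1, c1 h h' hv], fun v => ?_⟩
    have := c2 v
    rw [Finset.sum_congr rfl fun h _ => e2 h, ← Finset.mul_sum] at this
    exact (mul_eq_zero.1 this).resolve_left hk'
  · rintro ⟨c1, c2⟩
    refine ⟨fun h h' hv => by rw [e1, e1, c1 h h' hv], fun v => ?_⟩
    rw [Finset.sum_congr rfl fun h _ => e2 h, ← Finset.mul_sum, c2, mul_zero]

variable [DecidableEq E] (root : V → E × Bool)

/-- The coefficient vectors of the complex solutions of the linear system. -/
noncomputable abbrev complexSolutions (θ : E → ℝ) : Submodule ℂ (E × Bool → ℂ) :=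
  LinearMap.ker ((G.systemMatrix root θ).map (algebraMap ℝ ℂ)).mulVecLin

theorem mem_complexSolutions_iff (hroot : ∀ v, G.vert (root v) = v) {θ : E → ℝ}
    {x : E × Bool → ℂ} : x ∈ G.complexSolutions root θ ↔
      (∀ h h', G.vert h = G.vert h' → endValue θ x h = endValue θ x h') ∧
      ∀ v, ∑ h : E × Bool with G.vert h = v, endSlope θ x h = 0 := by
  rw [← G.systemMatrix_smul_eq_zero_iff root hroot, LinearMap.mem_ker, funext_iff]
  simp only [Matrix.mulVecLin_apply, Matrix.mulVec, dotProduct, Matrix.map_apply, Pi.zero_apply,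
    Complex.real_smul, Complex.coe_algebraMap]

/-- The eigenfunctions are the functions whose coefficients solve the linear system. -/
theorem eigenspace_laplacian (hroot : ∀ v, G.vert (root v) = v) {ℓ : E → ℝ} (hℓ : ∀ e, 0 < ℓ e)
    {k : ℝ} (hk : 0 < k) :
    (G.laplacian ℓ).eigenspace ((k : ℂ) ^ 2) =
      (G.complexSolutions root (k • ℓ)).map (waveL2 ℓ k) := by
  ext φ
  rw [LinearPMap.mem_eigenspace_iff, graph_laplacian]
  constructor
  · rintro ⟨f, f', h1, h2, h3, h4⟩
    have hwave : ∀ e, ∃ a b : ℂ, ∀ t ∈ Icc (-ℓ e / 2) (ℓ e / 2),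
        f e t = wave k a b t ∧ f' e t = wave k (k * b) (-(k * a)) t := fun e => by
      refine exists_eq_wave (hℓ e) hk (h2 e) ((h3 e).congr_deriv ?_)
      filter_upwards [h1 e, Lp.coeFn_smul ((k : ℂ) ^ 2) (φ e)] with t ht1 ht2
      simp only [PiLp.smul_apply, Pi.neg_apply, ht2, Pi.smul_apply, smul_eq_mul] at ht1 ⊢
      rw [ht1]
    choose a b hab using hwave
    let x : E × Bool → ℂ := fun c => if c.2 then b c.1 else a c.1
    refine ⟨x, (G.mem_complexSolutions_iff root hroot).2 ?_, ?_⟩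
    · refine (G.vertexConditions_wave_iff hk (fun h => ?_) fun h => ?_).1 h4
      · exact (hab h.1 _ (endParam_mem hℓ h)).1
      · exact (hab h.1 _ (endParam_mem hℓ h)).2
    · symm
      rw [eq_waveL2_iff]
      intro e
      refine (h1 e).trans ((ae_restrict_iff' measurableSet_Icc).2 (Eventually.of_forall ?_))
      exact fun t ht => (hab e t ht).1
  · rintro ⟨x, hx, rfl⟩
    refine ⟨fun e => wave k (x (e, false)) (x (e, true)),
      fun e => wave k (k * x (e, true)) (-(k * x (e, false))),
      waveL2_apply_ae ℓ k x, fun e => isACWithDeriv_wave _ _ _ _, fun e => ?_, ?_⟩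
    · refine (isACWithDeriv_wave (ℓ e) k _ _).congr_deriv ?_
      filter_upwards [waveL2_apply_ae ℓ k x e,
        Lp.coeFn_smul ((k : ℂ) ^ 2) (waveL2 ℓ k x e)] with t ht1 ht2
      simp only [PiLp.smul_apply, Pi.neg_apply, ht2, Pi.smul_apply, smul_eq_mul, ht1]
      simp only [wave]
      ring
    · exact (G.vertexConditions_wave_iff hk (fun _ => rfl) fun _ => rfl).2
        ((G.mem_complexSolutions_iff root hroot).1 hx)

theorem finrank_complexSolutions (θ : E → ℝ) :
    Module.finrank ℂ (G.complexSolutions root θ) = Module.finrank ℝ (G.solutions root θ) := by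
  have h1 := LinearMap.finrank_range_add_finrank_ker (G.systemMatrix root θ).mulVecLin
  have h2 := LinearMap.finrank_range_add_finrank_ker
    ((G.systemMatrix root θ).map (algebraMap ℝ ℂ)).mulVecLin
  have h3 := Matrix.rank_map_of_field (algebraMap ℝ ℂ) (G.systemMatrix root θ)
  rw [Matrix.rank, Matrix.rank] at h3
  simp only [Module.finrank_fintype_fun_eq_card] at h1 h2
  change _ + Module.finrank ℝ (G.solutions root θ) = _ at h1
  change _ + Module.finrank ℂ (G.complexSolutions root θ) = _ at h2
  omega

theorem rank_eigenspace (hroot : ∀ v, G.vert (root v) = v) {ℓ : E → ℝ} (hℓ : ∀ e, 0 < ℓ e)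
    {k : ℝ} (hk : 0 < k) :
    Module.rank ℂ ((G.laplacian ℓ).eigenspace ((k : ℂ) ^ 2)) =
      (Module.finrank ℝ (G.solutions root (k • ℓ)) : ℕ) := by
  rw [G.eigenspace_laplacian root hroot hℓ hk, ← finrank_complexSolutions,
    Module.finrank_eq_rank]
  exact (Submodule.equivMapOfInjective _ (waveL2_injective hℓ hk) _).rank_eq.symm

theorem ofReal_mem_complexSolutions {θ : E → ℝ} {x : E × Bool → ℝ}
    (hx : x ∈ G.solutions root θ) : (fun c => (x c : ℂ)) ∈ G.complexSolutions root θ := by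
  have h1 := (G.mem_solutions root).1 hx
  funext h
  have := congrFun h1 h
  simp only [Matrix.mulVec, dotProduct, Pi.zero_apply] at this
  simp only [Matrix.mulVecLin_apply, Matrix.mulVec, dotProduct, Matrix.map_apply, Pi.zero_apply,
    Complex.coe_algebraMap]
  exact_mod_cast this

end Eigen

end OrientedGraph

namespace OrientedGraph

variable {V E : Type*} [Fintype E] [DecidableEq E] [DecidableEq V] (G : OrientedGraph V E)
  (root : V → E × Bool)

/-! ### The singular points -/

theorem exists_solution_of_finrank_eq_one {θ : E → ℝ}
    (h : Module.finrank ℝ (G.solutions root θ) = 1) :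
    ∃ x ∈ G.solutions root θ, x ≠ 0 ∧ ∀ z ∈ G.solutions root θ, ∃ c : ℝ, z = c • x := by
  obtain ⟨x, hx0, hx⟩ := finrank_eq_one_iff'.1 h
  refine ⟨x.1, x.2, fun h0 => hx0 (Subtype.ext h0), fun z hz => ?_⟩
  obtain ⟨c, hc⟩ := hx ⟨z, hz⟩
  exact ⟨c, (congrArg Subtype.val hc).symm⟩

theorem mem_smoothPoints (hroot : ∀ v, G.vert (root v) = v) {θ : E → ℝ}
    (h : Module.finrank ℝ (G.solutions root θ) = 1) : torusPoint θ ∈ G.smoothPoints root := by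
  obtain ⟨x, hx, hx0, hxz⟩ := G.exists_solution_of_finrank_eq_one root h
  refine ⟨(G.mem_detManifold_iff root θ).2 ((Submodule.ne_bot_iff _).2 ⟨x, hx, hx0⟩), fun h0 => ?_⟩
  obtain ⟨r, hr, hd⟩ := G.exists_diffDelta_eq root hroot hx0 hx hxz
  have h1 := hd 1
  rw [h0, _root_.zero_apply] at h1
  have h2 := (mul_eq_zero.1 h1.symm).resolve_left hr
  rw [Finset.sum_eq_zero_iff_of_nonneg fun e _ => by simp; positivity] at h2
  apply massVec_self_ne_zero hx0
  funext e
  have := h2 e (Finset.mem_univ e)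
  simp only [Pi.one_apply, mul_one] at this
  simp only [massVec, Pi.zero_apply]
  linarith

/-- The singular points are those where the linear system has at least two independent
solutions. -/
theorem mem_singularPoints_iff (hroot : ∀ v, G.vert (root v) = v) {θ : E → ℝ} :
    torusPoint θ ∈ G.singularPoints root ↔ 2 ≤ Module.finrank ℝ (G.solutions root θ) := by
  constructor
  · rintro ⟨h1, h2⟩
    have h3 := Submodule.one_le_finrank_iff.2 ((G.mem_detManifold_iff root θ).1 h1)
    have h4 : Module.finrank ℝ (G.solutions root θ) ≠ 1 := fun h =>
      h2 (G.mem_smoothPoints root hroot h)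
    omega
  · intro h
    refine ⟨(G.mem_detManifold_iff root θ).2 fun hb => ?_, fun hs => hs.2 ?_⟩
    · rw [hb, finrank_bot] at h
      omega
    · exact G.diffDelta_eq_zero root h

/-- On a graph which is not a circle, the number of vertices is less than the number of edges if
there is a balanced orientation. -/
theorem card_lt_card_of_isBalanced {V E : Type*} [Fintype E] [DecidableEq V] [Fintype V]
    (G : OrientedGraph V E) (root : V → E × Bool) (hG : G.Connected)
    (hroot : ∀ v, G.vert (root v) = v) (hc : ¬ Nonempty (G.Realization ≃ₜ Circle)) {σ : E → Bool}
    (hσ : G.IsBalanced σ) : Fintype.card V < Fintype.card E := by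
  by_contra! hle
  have ht := hσ.tail_surjective hroot
  have hh := hσ.head_surjective hroot
  have hcard : Fintype.card E = Fintype.card V :=
    le_antisymm hle (Fintype.card_le_of_surjective _ ht)
  exact hc (hG.nonempty_realization_homeomorph_circle
    ((Fintype.bijective_iff_surjective_and_card _).2 ⟨ht, hcard⟩)
    ((Fintype.bijective_iff_surjective_and_card _).2 ⟨hh, hcard⟩))

/-- On a graph which is not a circle, the set where the linear system has at least two independent
solutions has codimension at least two. -/
theorem dimH_le_of_two_le_finrank (hG : G.Connected) (hroot : ∀ v, G.vert (root v) = v)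
    (hc : ¬ Nonempty (G.Realization ≃ₜ Circle)) {θ₀ : E → ℝ}
    (hθ₀ : 2 ≤ Module.finrank ℝ (G.solutions root θ₀)) :
    2 ≤ Fintype.card E ∧ dimH {θ | 2 ≤ Module.finrank ℝ (G.solutions root θ)} ≤
      (Fintype.card E - 2 : ℕ) := by
  classical
  have hri : Function.Injective root := fun v w h => by rw [← hroot v, ← hroot w, h]
  have : Fintype V := Fintype.ofInjective root hri
  have : Nonempty V := hG.nonempty
  -- The points where the polarized masses of the solutions are not all proportional.
  let good : (E → ℝ) → Prop := fun θ => ∃ z ∈ G.solutions root θ, ∃ x ∈ G.solutions root θ,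
    ∃ z' ∈ G.solutions root θ, ∃ x' ∈ G.solutions root θ,
      LinearIndependent ℝ ![massVec z x, massVec z' x']
  have hbad : ∀ θ, 2 ≤ Module.finrank ℝ (G.solutions root θ) → ¬ good θ →
      ∃ σ : E → Bool, G.IsBalanced σ ∧ θ ∈ G.circlePoints σ := by
    intro θ hθ hg
    obtain ⟨x, hx, z, hz, h1, h2, h3⟩ := G.exists_orthonormal_of_massVec root hG hroot hθ
      fun z hz x hx z' hz' x' hx' hli => hg ⟨z, hz, x, hx, z', hz', x', hx', hli⟩
    exact G.exists_isBalanced_of_orthonormal root hroot hx hz h1 h2 h3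
  have hlt := fun {σ : E → Bool} (hσ : G.IsBalanced σ) =>
    G.card_lt_card_of_isBalanced root hG hroot hc hσ
  constructor
  · by_cases hg : good θ₀
    · obtain ⟨z, hz, x, hx, z', hz', x', hx', hli⟩ := hg
      exact (G.exists_nhdsWithin_dimH_le_of_massVec root hroot hz hx hz' hx' hli).1
    · obtain ⟨σ, hσ, -⟩ := hbad θ₀ hθ₀ hg
      have := hlt hσ
      have := Fintype.card_pos (α := V)
      omega
  have hsub : {θ | 2 ≤ Module.finrank ℝ (G.solutions root θ)} ⊆
      (⋃ m : ℕ, {θ | Module.finrank ℝ (G.solutions root θ) = m ∧ good θ}) ∪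
        ⋃ σ : {σ : E → Bool // G.IsBalanced σ}, G.circlePoints σ.1 := by
    intro θ hθ
    by_cases hg : good θ
    · exact Or.inl (mem_iUnion.2 ⟨_, rfl, hg⟩)
    · obtain ⟨σ, hσ, h⟩ := hbad θ hθ hg
      exact Or.inr (mem_iUnion.2 ⟨⟨σ, hσ⟩, h⟩)
  refine (dimH_mono hsub).trans ?_
  rw [dimH_union, dimH_iUnion, dimH_iUnion]
  refine max_le (iSup_le fun m => dimH_le_of_locally fun θ hθ => ?_) (iSup_le fun σ => ?_)
  · obtain ⟨hm, z, hz, x, hx, z', hz', x', hx', hli⟩ := hθ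
    obtain ⟨-, t, ht, hd⟩ := G.exists_nhdsWithin_dimH_le_of_massVec root hroot hz hx hz' hx' hli
    refine ⟨t, nhdsWithin_mono θ ?_ ht, hd⟩
    exact fun τ hτ => hτ.1.trans hm.symm
  · refine (G.dimH_circlePoints_le σ.1).trans ?_
    have := hlt σ.2
    norm_cast
    omega

end OrientedGraph

theorem mainTheorem2 {V E : Type*} [DecidableEq V] [Fintype E] [DecidableEq E]
    (G : OrientedGraph V E) (hG : G.Connected)
    (root : V → E × Bool) (hroot : ∀ v, G.vert (root v) = v) :
    (∀ ℓ : E → ℝ, (∀ e, 0 < ℓ e) → ∀ k : ℝ, 0 < k →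
      ((G.laplacian ℓ).IsSimpleEigenvalue ((k : ℂ) ^ 2) →
        torusPoint (k • ℓ) ∈ G.smoothPoints root ∧
        ∀ φ ∈ (G.laplacian ℓ).eigenspace ((k : ℂ) ^ 2), φ ≠ 0 →
          (∃ a b : E → ℂ, OrientedGraph.HasEdgeForm φ k a b) ∧
          ∀ a b : E → ℂ, OrientedGraph.HasEdgeForm φ k a b →
            tangentVectors (G.detManifold root) (torusPoint (k • ℓ)) =
              {v : E → ℝ | ∑ e, (a e ^ 2 + b e ^ 2) * (v e : ℂ) = 0}) ∧
      ((G.laplacian ℓ).IsDegenerateEigenvalue ((k : ℂ) ^ 2) →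
        torusPoint (k • ℓ) ∈ G.singularPoints root)) ∧
    (¬ Nonempty (G.Realization ≃ₜ Circle) →
      HasCodimAtLeast 1 (G.singularPoints root) (G.detManifold root)) := by
  refine ⟨fun ℓ hℓ k hk => ⟨fun hs => ?_, fun hd => ?_⟩, fun hc => ⟨sdiff_subset, ?_⟩⟩
  · have hrank : Module.finrank ℝ (G.solutions root (k • ℓ)) = 1 := by
      rw [LinearPMap.IsSimpleEigenvalue, G.rank_eigenspace root hroot hℓ hk] at hs
      exact_mod_cast hs
    have hsm := G.mem_smoothPoints root hroot hrank
    refine ⟨hsm, fun φ hφ hφ0 => ?_⟩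
    rw [G.eigenspace_laplacian root hroot hℓ hk] at hφ
    obtain ⟨X, hX, rfl⟩ := hφ
    refine ⟨⟨_, _, OrientedGraph.waveL2_apply_ae ℓ k X⟩, fun a b hab => ?_⟩
    have hXab : X = fun c => if c.2 then b c.1 else a c.1 :=
      OrientedGraph.waveL2_injective hℓ hk (OrientedGraph.eq_waveL2_iff.2 (by simpa using hab))
    obtain ⟨x, hx, hx0, hxz⟩ := G.exists_solution_of_finrank_eq_one root hrank
    obtain ⟨r, hr, hdiff⟩ := G.exists_diffDelta_eq root hroot hx0 hx hxz
    -- The eigenfunction is a complex multiple of a real one.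
    obtain ⟨c, hcX⟩ : ∃ c : ℂ, c • (fun i => (x i : ℂ)) = X := by
      have h1 : Module.finrank ℂ (G.complexSolutions root (k • ℓ)) = 1 := by
        rw [G.finrank_complexSolutions, hrank]
      have h2 : (⟨_, G.ofReal_mem_complexSolutions root hx⟩ :
          G.complexSolutions root (k • ℓ)) ≠ 0 := fun h => hx0 (by
        funext i
        have := congrFun (congrArg Subtype.val h) i
        simpa using this)
      obtain ⟨c, hc⟩ := (finrank_eq_one_iff_of_nonzero' _ h2).1 h1 ⟨X, hX⟩
      exact ⟨c, congrArg Subtype.val hc⟩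
    have hc0 : c ≠ 0 := by
      rintro rfl
      rw [zero_smul] at hcX
      exact hφ0 (by rw [← hcX, map_zero])
    have ha : ∀ e, a e = c * x (e, false) := fun e => by
      have := congrFun hXab (e, false)
      rw [← hcX] at this
      simpa using this.symm
    have hb : ∀ e, b e = c * x (e, true) := fun e => by
      have := congrFun hXab (e, true)
      rw [← hcX] at this
      simpa using this.symm
    rw [G.tangentVectors_detManifold root hsm]
    ext v
    have hsum : ∑ e, (a e ^ 2 + b e ^ 2) * (v e : ℂ) =
        c ^ 2 * ((∑ e, (x (e, false) ^ 2 + x (e, true) ^ 2) * v e : ℝ) : ℂ) := by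
      push_cast
      rw [Finset.mul_sum]
      refine Finset.sum_congr rfl fun e _ => ?_
      rw [ha, hb]
      ring
    rw [mem_ofPred_eq, mem_ofPred_eq, hdiff, hsum, mul_eq_zero, mul_eq_zero, Complex.ofReal_eq_zero,
      or_iff_right hr, or_iff_right (pow_ne_zero 2 hc0)]
  · rw [G.mem_singularPoints_iff root hroot]
    rw [LinearPMap.IsDegenerateEigenvalue, G.rank_eigenspace root hroot hℓ hk] at hd
    exact_mod_cast hd
  · intro z hz U hU
    obtain ⟨θ₀, rfl⟩ := OrientedGraph.exists_torusPoint_eq z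
    obtain ⟨v₀⟩ := hG.nonempty
    obtain ⟨h2, hdim⟩ := G.dimH_le_of_two_le_finrank root hG hroot hc
      ((G.mem_singularPoints_iff root hroot).1 hz)
    have hsub : G.singularPoints root ∩ U ⊆
        torusPoint '' {θ | 2 ≤ Module.finrank ℝ (G.solutions root θ)} := by
      rintro p ⟨hp, -⟩
      obtain ⟨θ, rfl⟩ := OrientedGraph.exists_torusPoint_eq p
      exact ⟨θ, (G.mem_singularPoints_iff root hroot).1 hp, rfl⟩
    calc dimH (G.singularPoints root ∩ U) + 1 ≤ ((Fintype.card E - 2 : ℕ) : ℝ≥0∞) + 1 := by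
          gcongr
          exact (dimH_mono hsub).trans
            ((OrientedGraph.lipschitzWith_torusPoint.dimH_image_le _).trans hdim)
      _ = ((Fintype.card E - 1 : ℕ) : ℝ≥0∞) := by
          norm_cast
          omega
      _ ≤ dimH (G.detManifold root ∩ U) := G.le_dimH_detManifold root hroot (root v₀).1 hz.1 hU
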